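/- Fix $N\ge 2$. Let $\mathbf P=\mathbb C[t_1,\dots,t_N]$, let $\mathrm{loc}\subset\mathbf P$ be the multiplicative set of products of differences $t_a-t_b$ with $a\ne b$ in $\{1,\dots,N\}$, and let $(\cdot)^{loc}$ denote localisation at $\mathrm{loc}$. For $0\le n\le N$ let $\Lambda_n$ be the set of words $\lambda\in\{0,1\}^N$ with exactly $n$ letters $1$, and $\Lambda=\bigcup_n\Lambda_n$. The symmetric group acts on words by $(w\lambda)_j=\lambda_{w^{-1}(j)}$. *Algebraic side.* Let $V=\mathbb C^2$ with basis $v_0,v_1$, and let $\mathbb V_N=V^{\otimes N}\otimes\mathbf P$ with $\mathbf P$-basis $v_\lambda=v_{\lambda_1}\otimes\cdots\otimes v_{\lambda_N}$, $\lambda\in\Lambda$. Let $$L(x,t)=\begin{pmatrix}1&0&0&0\\0&x+t&1&0\\0&1&0&0\\0&0&0&1\end{pmatrix}$$ act on $V\otimes V$ in the ordered basis $v_0\otimes v_0,\,v_0\otimes v_1,\,v_1\otimes v_0,\,v_1\otimes v_1$. Let $M(x)=L_{0N}(x,t_N)\cdots L_{02}(x,t_2)L_{01}(x,t_1)$, acting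 on $V\otimes\mathbb V_N[x]$ (with tensor factors numbered $0,1,\dots,N$), and write $M(x)=\begin{pmatrix}A(x)&B(x)\\C(x)&D(x)\end{pmatrix}$ with respect to the $0$th factor. For $\lambda\in\Lambda$ with $\{i\mid\lambda_i=0\}=\{i_1<\dots<i_k\}$, the normalised Bethe vector is $$\mathbb b_\lambda=\prod_{a,b:\ \lambda_a=1,\ \lambda_b=0}(t_a-t_b)^{-1}\;C(-t_{i_1})\cdots C(-t_{i_k})\,v_{(1,\dots,1)}\in\mathbb V_N^{loc}.$$ *Geometric side.* Let $X_n=\mathrm{Gr}(n,N)$ be the Grassmannian of $n$-dimensional subspaces of $\mathbb C^N$ and $T$ the torus of invertible diagonal matrices. The $T$-fixed points of $X_n$ are the coordinate planes $\mathbf w_\lambda=\operatorname{span}(e_i\mid\lambda_i=1)$, $\lambda\in\Lambda_n$. By restriction to the fixed points, $H_T^*(X_n)$ is identified with the $\mathbf P$-module of GKM classes, i.e. of the functions $\alpha:X_n^T\to\mathbf P$, written $\alpha(\lambda)=\alpha(\mathbf w_\lambda)$, such that $t_i-t_j$ divides $\alpha(\lambda)-\alpha(\mu)$ whenever $\mu=s_{ij}\lambda$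 for a transposition $s_{ij}$. For $\lambda,\mu\in\Lambda_n$ write $\mu\ge\lambda$ if $\sum_{i\le j}\mu_i\ge\sum_{i\le j}\lambda_i$ for all $j$, and, for a permutation $w$, write $\mu\ge_w\lambda$ if $w^{-1}\mu\ge w^{-1}\lambda$. Let $\operatorname{inv}_w(\lambda)=\{(i,j)\mid w^{-1}(i)<w^{-1}(j),\ \lambda_i>\lambda_j\}$ and let $\ell(\lambda)$ be the number of pairs $i<j$ with $\lambda_i>\lambda_j$. The $w$-twisted Schubert class $S^w_\lambda$ of $\lambda\in\Lambda_n$ is the unique GKM class such that 1. $S^w_\lambda(\lambda)\neq0$, and $S^w_\lambda(\mu)\ne0$ implies $\mu\ge_w\lambda$; 2. $S^w_\lambda(\lambda)=\prod_{(i,j)\in\operatorname{inv}_w(\lambda)}(t_i-t_j)$; 3. $\deg S^w_\lambda(\mu)=\ell(w^{-1}\lambda)$ for all $\mu\ge_w\lambda$, where $\deg$ is the total degree. Let $\omega_0$ be the longest permutation $i\mapsto N+1-i$. **Corollary.** The classes $S^{\omega_0}_\lambda$ exist and are unique, restriction to the fixed points induces isomorphisms $H_T^*(X_n)^{loc}\cong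 \mathrm{Maps}(X_n^T,\mathbf P)^{loc}$ for $0\le n\le N$, and there is a unique $\mathbf P^{loc}$-linear map $$\Psi:\ \mathbb V_N^{loc}\longrightarrow\bigoplus_{n=0}^N H_T^*(X_n)^{loc},\qquad \Psi(v_\lambda)=S^{\omega_0}_\lambda\quad(\lambda\in\Lambda).$$ The map $\Psi$ is an isomorphism, and for every $\lambda\in\Lambda$ $$\Psi(\mathbb b_\lambda)=\mathbb 1_{\mathbf w_\lambda},$$ where $\mathbb 1_{p}$, $p\in X_n^T$, denotes the fixed point basis vector, $\mathbb 1_p(p')=\delta_{p,p'}$. -/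

import Mathlib

open scoped TensorProduct

namespace BetheGr

noncomputable section

/-! ### Words, polynomials, permutations -/

/-- The polynomial ring `P = ℂ[t_1, …, t_N]`; the variable `t_i` is `MvPolynomial.X i`. -/
abbrev P (N : ℕ) : Type := MvPolynomial (Fin N) ℂ

/-- `Λ = {0,1}^N`. -/
abbrev Word (N : ℕ) : Type := Fin N → Fin 2

/-- `Λ_n`: the words of length `N` with exactly `n` letters `1`. -/
abbrev WordOf (N n : ℕ) : Type := {l : Word N // ∑ i, (l i : ℕ) = n}

/-- The action of permutations on words, `(w λ)_j = λ_{w⁻¹ j}`. -/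
def permWord {N : ℕ} (w : Equiv.Perm (Fin N)) (l : Word N) : Word N := fun j => l (w⁻¹ j)

/-- The multiplicative set `loc` of all products of the differences `t_a - t_b`, `a ≠ b`. -/
def loc (N : ℕ) : Submonoid (P N) :=
  Submonoid.closure {f | ∃ a b : Fin N, a ≠ b ∧ f = MvPolynomial.X a - MvPolynomial.X b}

/-! ### The algebraic side: `V^{⊗N} ⊗ P`, the monodromy matrix, Bethe vectors -/

/-- `𝕍_N = V^{⊗N} ⊗ P` with `V = ℂ²`, as a `P`-module. -/
abbrev VN (N : ℕ) : Type := P N ⊗[ℂ] (⨂[ℂ] _ : Fin N, (Fin 2 → ℂ))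

/-- The standard (spin) basis `v_λ = v_{λ_1} ⊗ ⋯ ⊗ v_{λ_N}` of the `P`-module `𝕍_N`. -/
def vBasis (N : ℕ) : Module.Basis (Word N) (P N) (VN N) :=
  (Basis.piTensorProduct fun _ : Fin N => Pi.basisFun ℂ (Fin 2)).baseChange (P N)

/-- The Lax matrix `L(x,t)`, an endomorphism of `V ⊗ V`, in the ordered basis
`v_0 ⊗ v_0, v_0 ⊗ v_1, v_1 ⊗ v_0, v_1 ⊗ v_1`; the row is the output, the column the input. -/
def lax {R : Type*} [CommRing R] (x t : R) : Matrix (Fin 2 × Fin 2) (Fin 2 × Fin 2) R :=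
  fun p q =>
    (!![1, 0, 0, 0;
        0, x + t, 1, 0;
        0, 1, 0, 0;
        0, 0, 0, 1] : Matrix (Fin 4) (Fin 4) R) (finProdFinEquiv p) (finProdFinEquiv q)

/-- `L_{0j}(x,t)`: acts as `L(x,t)` on the `0`-th and `j`-th tensor factors and as the identity on
the others, as a matrix in the basis `v_a ⊗ v_λ`. -/
def lax0 {R : Type*} [CommRing R] {N : ℕ} (j : Fin N) (x t : R) :
    Matrix (Fin 2 × Word N) (Fin 2 × Word N) R :=
  fun p q => if ∀ i, i ≠ j → p.2 i = q.2 i then lax x t (p.1, p.2 j) (q.1, q.2 j) else 0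

/-- The monodromy matrix `M(x,t_1,…,t_N) = L_{0N}(x,t_N) ⋯ L_{02}(x,t_2) L_{01}(x,t_1)`. -/
def monodromy {R : Type*} [CommRing R] {N : ℕ} (x : R) (t : Fin N → R) :
    Matrix (Fin 2 × Word N) (Fin 2 × Word N) R :=
  ((List.finRange N).reverse.map fun j => lax0 j x (t j)).prod

/-- The operator `C(y) ∈ End_P(𝕍_N)`, `y ∈ P`: the lower left block of the monodromy matrix
`M = (A B; C D)`, with the spectral parameter `x` specialised to `y`. -/
def opC {N : ℕ} (y : P N) : Module.End (P N) (VN N) :=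
  Matrix.toLin (vBasis N) (vBasis N)
    (Matrix.of fun l m : Word N =>
      monodromy y (fun i => (MvPolynomial.X i : P N)) ((1 : Fin 2), l) ((0 : Fin 2), m))

/-- The Bethe vector `𝔟(η) = C(-t_{i_1}) ⋯ C(-t_{i_k}) v_{(1,…,1)} ∈ 𝕍_N`, where
`i_1 < ⋯ < i_k` are the positions of the letter `0` in `λ`. -/
def betheVec {N : ℕ} (l : Word N) : VN N :=
  (((List.finRange N).filter fun i => l i = 0).map
    fun i => opC (-(MvPolynomial.X i : P N))).prod (vBasis N fun _ => 1)

/-- `∏_{λ_b = 0, λ_a = 1} (t_a - t_b)`, an element of `loc`. -/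
def betheDenom {N : ℕ} (l : Word N) : loc N :=
  ⟨∏ p ∈ Finset.univ.filter (fun p : Fin N × Fin N => l p.1 ≠ 0 ∧ l p.2 = 0),
      (MvPolynomial.X p.1 - MvPolynomial.X p.2), by
    refine Submonoid.prod_mem _ fun p hp => Submonoid.subset_closure ⟨p.1, p.2, ?_, rfl⟩
    rintro h
    simp only [Finset.mem_filter, Finset.mem_univ, true_and] at hp
    exact hp.1 (h ▸ hp.2)⟩

/-- The normalised Bethe vector
`𝔟_λ = ∏_{λ_b = 0, λ_a = 1} (t_a - t_b)⁻¹ 𝔟(η)` in `𝕍_N^loc`. -/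
def normBetheVec {N : ℕ} (l : Word N) : LocalizedModule (loc N) (VN N) :=
  LocalizedModule.mk (betheVec l) (betheDenom l)

/-! ### The geometric side: Grassmannians, fixed points, equivariant cohomology -/

/-- The Grassmannian `X_n = Gr(n, N)` of `n`-dimensional subspaces of `ℂ^N`. -/
abbrev Gr (N n : ℕ) : Type := {W : Submodule ℂ (Fin N → ℂ) // Module.finrank ℂ W = n}

/-- A point of the Grassmannian is fixed by the torus `T` of invertible diagonal matrices. -/
def IsTorusFixed {N n : ℕ} (p : Gr N n) : Prop :=
  ∀ d : Fin N → ℂˣ, p.1.map (Matrix.toLin' (Matrix.diagonal fun i => (d i : ℂ))) = p.1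

/-- The set `X_n^T` of torus fixed points. -/
abbrev FixedPt (N n : ℕ) : Type := {p : Gr N n // IsTorusFixed p}

/-- The coordinate plane `ℂ^λ`, spanned by the `e_i` with `λ_i = 1`. -/
def coordPlane {N : ℕ} (l : Word N) : Submodule ℂ (Fin N → ℂ) :=
  Submodule.span ℂ (Set.range fun i : {i // l i = 1} => (Pi.single i.1 1 : Fin N → ℂ))

theorem sum_word_eq_card {N : ℕ} (l : Word N) :
    ∑ i, (l i : ℕ) = Fintype.card {i // l i = 1} := by
  rw [Fintype.card_subtype, Finset.card_filter]
  refine Finset.sum_congr rfl fun i _ => ?_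
  generalize l i = a
  fin_cases a <;> simp

theorem finrank_coordPlane {N n : ℕ} (l : WordOf N n) :
    Module.finrank ℂ (coordPlane l.1) = n := by
  have h : LinearIndependent ℂ
      (fun i : {i // l.1 i = 1} => (Pi.single i.1 1 : Fin N → ℂ)) := by
    have h0 := (Pi.basisFun ℂ (Fin N)).linearIndependent
    have h1 := h0.comp (fun i : {i // l.1 i = 1} => i.1) Subtype.val_injective
    convert h1 using 1
    funext i
    simp
  rw [coordPlane, finrank_span_eq_card h, ← sum_word_eq_card, l.2]

theorem coordPlane_map_le {N : ℕ} (l : Word N) (d : Fin N → ℂ) :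
    (coordPlane l).map (Matrix.toLin' (Matrix.diagonal d)) ≤ coordPlane l := by
  rw [coordPlane, Submodule.map_span, Submodule.span_le]
  rintro _ ⟨_, ⟨i, rfl⟩, rfl⟩
  have : Matrix.toLin' (Matrix.diagonal d) (Pi.single i.1 1 : Fin N → ℂ)
      = d i.1 • (Pi.single i.1 1 : Fin N → ℂ) := by
    rw [Matrix.toLin'_apply]
    ext k
    rw [Matrix.mulVec_diagonal]
    by_cases h : k = i.1
    · subst h; simp
    · simp [Pi.single_eq_of_ne h]
  rw [this]
  exact Submodule.smul_mem _ _ (Submodule.subset_span ⟨i, rfl⟩)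

theorem isTorusFixed_coordPlane {N n : ℕ} (l : WordOf N n) :
    IsTorusFixed (⟨coordPlane l.1, finrank_coordPlane l⟩ : Gr N n) := by
  intro d
  refine le_antisymm (coordPlane_map_le _ _) fun x hx => ?_
  refine ⟨Matrix.toLin' (Matrix.diagonal fun i => ((d i)⁻¹ : ℂ)) x,
    coordPlane_map_le _ _ ⟨x, hx, rfl⟩, ?_⟩
  rw [Matrix.toLin'_apply, Matrix.toLin'_apply]
  ext k
  rw [Matrix.mulVec_diagonal, Matrix.mulVec_diagonal]
  simp

/-- The torus fixed point `w_λ = ℂ^λ` of `X_n` corresponding to `λ ∈ Λ_n`. -/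
def fixedPt {N n : ℕ} (l : WordOf N n) : FixedPt N n :=
  ⟨⟨coordPlane l.1, finrank_coordPlane l⟩, isTorusFixed_coordPlane l⟩

/-- `H_T^*(X_n)` as a `P`-module, `P = H_T^*(pt)`: restriction to the fixed points identifies it
with the submodule of `H_T^*(X_n^T) = Maps(X_n^T, P)` of all GKM classes, that is, of all `α` with
`α(λ) ≡ α(μ) mod (t_i - t_j)` whenever `μ = s_{ij} λ`. -/
def HT (N n : ℕ) : Submodule (P N) (FixedPt N n → P N) where
  carrier := {α | ∀ (l m : WordOf N n) (i j : Fin N), m.1 = permWord (Equiv.swap i j) l.1 →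
    (MvPolynomial.X i - MvPolynomial.X j : P N) ∣ α (fixedPt l) - α (fixedPt m)}
  zero_mem' := by
    intro l m i j _
    simp
  add_mem' := by
    intro a b ha hb l m i j h
    have := dvd_add (ha l m i j h) (hb l m i j h)
    rwa [← add_sub_add_comm] at this
  smul_mem' := by
    intro c a ha l m i j h
    have := (ha l m i j h).mul_left c
    rwa [mul_sub] at this

/-- The partial order on words: `μ ≥ λ` iff every initial segment of `μ` contains at least as many
letters `1` as that of `λ`. -/
def wordGE {N : ℕ} (m l : Word N) : Prop :=
  ∀ j : Fin N, ∑ i ∈ Finset.Iic j, (l i : ℕ) ≤ ∑ i ∈ Finset.Iic j, (m i : ℕ)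

/-- The twisted order `μ ≥_w λ`, i.e. `w⁻¹ μ ≥ w⁻¹ λ`. -/
def wordGEw {N : ℕ} (w : Equiv.Perm (Fin N)) (m l : Word N) : Prop :=
  wordGE (permWord w⁻¹ m) (permWord w⁻¹ l)

/-- `inv_w(λ) = {(i,j) | w⁻¹(i) < w⁻¹(j), λ_i > λ_j}`. -/
def invSet {N : ℕ} (w : Equiv.Perm (Fin N)) (l : Word N) : Finset (Fin N × Fin N) :=
  Finset.univ.filter fun p => w⁻¹ p.1 < w⁻¹ p.2 ∧ l p.2 < l p.1

/-- The length `ℓ(λ)`: the number of inversions `i < j`, `λ_i > λ_j`. -/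
def wordLength {N : ℕ} (l : Word N) : ℕ := (invSet 1 l).card

/-- The characterising properties of the `w`-twisted Schubert class `S^w_λ ∈ H_T^*(X_n)`. -/
structure IsTwistedSchubertClass {N n : ℕ} (w : Equiv.Perm (Fin N)) (l : WordOf N n)
    (S : HT N n) : Prop where
  /-- `λ` lies in the support. -/
  mem_support : S.1 (fixedPt l) ≠ 0
  /-- The support lies in `{μ | μ ≥_w λ}`. -/
  support_ge : ∀ m : WordOf N n, S.1 (fixedPt m) ≠ 0 → wordGEw w m.1 l.1
  /-- The normalisation at `λ`. -/
  value : S.1 (fixedPt l) =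
    ∏ p ∈ invSet w l.1, (MvPolynomial.X p.1 - MvPolynomial.X p.2 : P N)
  /-- The degree condition. -/
  degree : ∀ m : WordOf N n, wordGEw w m.1 l.1 →
    (S.1 (fixedPt m)).totalDegree = wordLength (permWord w⁻¹ l.1)

/-- `P^loc`. -/
abbrev Ploc (N : ℕ) : Type := Localization (loc N)

/-- `𝕍_N^loc`. -/
abbrev VNloc (N : ℕ) : Type := LocalizedModule (loc N) (VN N)

/-- `H_T^*(X_n)^loc`. -/
abbrev HTloc (N n : ℕ) : Type := LocalizedModule (loc N) (HT N n)

/-- `H_T^*(X_n^T)^loc`, the localisation of `Maps(X_n^T, P)`. -/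
abbrev FuncLoc (N n : ℕ) : Type := LocalizedModule (loc N) (FixedPt N n → P N)

/-- The localised restriction to the fixed points `H_T^*(X_n)^loc → H_T^*(X_n^T)^loc`. -/
def resLoc (N n : ℕ) : HTloc N n →ₗ[Ploc N] FuncLoc N n :=
  LocalizedModule.map (loc N) (HT N n).subtype

open Classical in
/-- The fixed point basis vector `𝟙_p`, `𝟙_p(p') = δ_{p,p'}`. -/
def fixedPtVec {N n : ℕ} (p : FixedPt N n) : FuncLoc N n :=
  LocalizedModule.mk (Pi.single p (1 : P N)) 1

end

end BetheGr

namespace BetheGr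

/-! ### Recursion of the monodromy matrix in the number of sites -/

section Monodromy

variable {R : Type*} [CommRing R] {N : ℕ}

/-! The values of the Schubert classes are themselves coordinates of Bethe vectors, and the theorem
is an orthogonality relation between two families of such vectors. Apply to the all-ones vector the
operators C(t_i), over all i with μ_i = 1, of the monodromy matrix with parameters -t. The
coordinate of the result at the complement of λ is S_λ(μ) (`schubert`).

Everything rests on splitting off the first site. The operators C and D obey quadratic relations
(`exchange_relations`), so a Bethe vector depends only on the multiset of its spectral parameters.
Its part with leading letter 1 is a scalar times the Bethe vector on the remaining sites
(`slice_one_bvec`). Its part with leading letter 0 is a combination of Bethe vectors with one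
parameter deleted (`slice_zero_bvec_finset`).

Induction on the number of sites then evaluates the pairing of the two families as ∏ (y + a)
(`pair_bvec`). For the parameters y = -t_j with λ_j = 0 and a = t_i with μ_i = 1 this is ∏ (t_i -
t_j). It has a zero factor unless λ = μ, and for λ = μ it is the denominator of the normalised Bethe
vector. Hence the Schubert expansion of that vector has the values of a delta function.

That `schubert` has the defining properties follows from the same recursions. The GKM condition
holds because C(x) ≡ C(y) mod x - y (`dvd_schubert_sub`). Support and nonvanishing come from
deleting a letter 1 (`suffixGE_of_schubert_ne_zero`, `schubert_ne_zero`), and the degree from a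
grading of the operators (`graded_act`). Uniqueness is a divisibility against degree argument
(`IsTwistedSchubertClass.unique`). Finally Ψ is surjective because every fixed point vector is hit,
and then injective because both sides are free of the same finite rank. -/

theorem sum_word_succ {M : Type*} [AddCommMonoid M] (f : Word (N + 1) → M) :
    ∑ k, f k = ∑ k : Word N, f (Fin.cons 0 k) + ∑ k : Word N, f (Fin.cons 1 k) := by
  rw [← (Fin.consEquiv fun _ : Fin (N + 1) => Fin 2).sum_comp, Fintype.sum_prod_type,
    Fin.sum_univ_two]
  rfl

/-- Extend a matrix on the sites `1, …, N` by the identity on an additional first site. -/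
def siteLift (M : Matrix (Fin 2 × Word N) (Fin 2 × Word N) R) :
    Matrix (Fin 2 × Word (N + 1)) (Fin 2 × Word (N + 1)) R :=
  fun p q => if p.2 0 = q.2 0 then M (p.1, Fin.tail p.2) (q.1, Fin.tail q.2) else 0

theorem siteLift_one : siteLift (1 : Matrix (Fin 2 × Word N) (Fin 2 × Word N) R) = 1 := by
  ext ⟨a, l⟩ ⟨b, m⟩
  induction l using Fin.consCases with | _ r l => ?_
  induction m using Fin.consCases with | _ s m => ?_
  simp only [siteLift, Fin.cons_zero, Fin.tail_cons, Matrix.one_apply, Prod.mk.injEq,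
    Fin.cons_inj]
  by_cases h : r = s <;> simp [h]

theorem siteLift_mul (M M' : Matrix (Fin 2 × Word N) (Fin 2 × Word N) R) :
    siteLift (M * M') = siteLift M * siteLift M' := by
  ext ⟨a, l⟩ ⟨b, m⟩
  induction l using Fin.consCases with | _ r l => ?_
  induction m using Fin.consCases with | _ s m => ?_
  simp only [siteLift, Fin.cons_zero, Fin.tail_cons, Matrix.mul_apply, Fintype.sum_prod_type,
    sum_word_succ]
  fin_cases r <;> fin_cases s <;> simp

/-- `siteLift` as a homomorphism of monoids. -/
def siteLiftHom : Matrix (Fin 2 × Word N) (Fin 2 × Word N) R →*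
    Matrix (Fin 2 × Word (N + 1)) (Fin 2 × Word (N + 1)) R where
  toFun := siteLift
  map_one' := siteLift_one
  map_mul' := siteLift_mul

theorem lax0_succ (j : Fin N) (x t : R) : lax0 j.succ x t = siteLift (lax0 j x t) := by
  ext ⟨a, l⟩ ⟨b, m⟩
  simp only [lax0, siteLift, Fin.forall_fin_succ, Fin.succ_inj, Fin.tail, ne_eq]
  have : ¬ (0 : Fin (N + 1)) = j.succ := (Fin.succ_ne_zero j).symm
  by_cases h : l 0 = m 0
  · simp only [h, this, not_false_eq_true, forall_const, true_and, if_true]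
    rfl
  · simp [h, this]

theorem monodromy_eq_mul (x : R) (t : Fin (N + 1) → R) :
    monodromy x t = siteLift (monodromy x (Fin.tail t)) * lax0 0 x (t 0) := by
  have := map_list_prod (siteLiftHom (R := R) (N := N))
    ((List.finRange N).reverse.map fun j => lax0 j x (Fin.tail t j))
  rw [monodromy, monodromy, List.finRange_succ, List.reverse_cons, List.map_append,
    List.prod_append]
  change siteLift _ = _ at this
  rw [this]
  simp only [List.map_cons, List.map_nil, List.prod_singleton, ← List.map_reverse, List.map_map]
  congr 2
  refine List.map_congr_left fun j _ => ?_
  exact lax0_succ j x (t j.succ)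

/-- The factor of the first site stands rightmost in the product, so it acts first; only the
auxiliary index c is passed on to the other sites. -/
theorem monodromy_succ (x : R) (t : Fin (N + 1) → R) (a b r s : Fin 2) (l m : Word N) :
    monodromy x t (a, Fin.cons r l) (b, Fin.cons s m) =
      ∑ c, monodromy x (Fin.tail t) (a, l) (c, m) * lax x (t 0) (c, r) (b, s) := by
  rw [monodromy_eq_mul, Matrix.mul_apply, Fintype.sum_prod_type]
  refine Finset.sum_congr rfl fun c _ => ?_
  rw [Finset.sum_eq_single (Fin.cons r m : Word (N + 1))]
  · rw [siteLift, lax0, if_pos, if_pos]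
    · simp [Fin.tail_cons]
    · intro i hi
      obtain ⟨j, rfl⟩ := Fin.exists_succ_eq.2 hi
      simp
    · simp
  · intro k _ hk
    induction k using Fin.consCases with | _ u k => ?_
    by_cases h : r = u
    · subst h
      have hkm : k ≠ m := fun h => hk (by rw [h])
      obtain ⟨j, hj⟩ := Function.ne_iff.1 hkm
      rw [lax0, if_neg, mul_zero]
      intro hall
      exact hj (by simpa using hall j.succ (Fin.succ_ne_zero j))
    · rw [siteLift, if_neg, zero_mul]
      simpa using h
  · simp

/-- The block of the monodromy matrix with output `a` and input `b` on the auxiliary factor, acting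
on coordinate vectors. -/
def blockAct (a b : Fin 2) (x : R) (t : Fin N → R) : (Word N → R) →ₗ[R] (Word N → R) :=
  Matrix.mulVecLin (Matrix.of fun l m : Word N => monodromy x t (a, l) (b, m))

theorem blockAct_apply (a b : Fin 2) (x : R) (t : Fin N → R) (f : Word N → R) (l : Word N) :
    blockAct a b x t f l = ∑ m, monodromy x t (a, l) (b, m) * f m := rfl

/-- The coordinates with first letter `s` of a vector on `N + 1` sites. -/
def slice (s : Fin 2) : (Word (N + 1) → R) →ₗ[R] (Word N → R) :=
  LinearMap.funLeft R R fun l => Fin.cons s l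

theorem slice_apply (s : Fin 2) (f : Word (N + 1) → R) (l : Word N) :
    slice s f l = f (Fin.cons s l) := rfl

theorem ext_slice {f g : Word (N + 1) → R} (h0 : slice 0 f = slice 0 g)
    (h1 : slice 1 f = slice 1 g) : f = g := by
  ext l
  induction l using Fin.consCases with | _ r l => ?_
  fin_cases r
  · exact congrFun h0 l
  · exact congrFun h1 l

/-- The action of the operator `C(x)` on coordinate vectors. -/
abbrev actC (x : R) (t : Fin N → R) : (Word N → R) →ₗ[R] (Word N → R) := blockAct 1 0 x t

/-- The action of the operator `D(x)` on coordinate vectors. -/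
abbrev actD (x : R) (t : Fin N → R) : (Word N → R) →ₗ[R] (Word N → R) := blockAct 1 1 x t

theorem slice_blockAct (a b s : Fin 2) (x : R) (t : Fin (N + 1) → R) (f : Word (N + 1) → R) :
    slice s (blockAct a b x t f) =
      ∑ c, ∑ r, lax x (t 0) (c, s) (b, r) • blockAct a c x (Fin.tail t) (slice r f) := by
  ext l
  rw [slice_apply, blockAct_apply, sum_word_succ]
  simp only [monodromy_succ, Pi.add_apply, Pi.smul_apply, blockAct_apply, slice_apply,
    smul_eq_mul, Fin.sum_univ_two, Finset.mul_sum, ← Finset.sum_add_distrib]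
  refine Finset.sum_congr rfl fun m _ => ?_
  ring

theorem slice_zero_actC (x : R) (t : Fin (N + 1) → R) (f : Word (N + 1) → R) :
    slice 0 (actC x t f) =
      actC x (Fin.tail t) (slice 0 f) + actD x (Fin.tail t) (slice 1 f) := by
  simp [slice_blockAct, Fin.sum_univ_two, lax, finProdFinEquiv]

theorem slice_one_actC (x : R) (t : Fin (N + 1) → R) (f : Word (N + 1) → R) :
    slice 1 (actC x t f) = (x + t 0) • actC x (Fin.tail t) (slice 1 f) := by
  simp [slice_blockAct, Fin.sum_univ_two, lax, finProdFinEquiv]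

theorem slice_zero_actD (x : R) (t : Fin (N + 1) → R) (f : Word (N + 1) → R) :
    slice 0 (actD x t f) = 0 := by
  simp [slice_blockAct, Fin.sum_univ_two, lax, finProdFinEquiv]

theorem slice_one_actD (x : R) (t : Fin (N + 1) → R) (f : Word (N + 1) → R) :
    slice 1 (actD x t f) =
      actC x (Fin.tail t) (slice 0 f) + actD x (Fin.tail t) (slice 1 f) := by
  simp [slice_blockAct, Fin.sum_univ_two, lax, finProdFinEquiv]

theorem actC_zero_sites (x : R) (t : Fin 0 → R) : actC x t = 0 := by
  ext1 f
  ext l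
  simp [blockAct_apply, monodromy]

theorem actD_zero_sites (x : R) (t : Fin 0 → R) : actD x t = LinearMap.id := by
  ext1 f
  ext l
  simp [blockAct_apply, monodromy, Subsingleton.elim _ l]

/-- The Yang–Baxter exchange relations between the operators `C` and `D`. -/
theorem exchange_relations (x y : R) (t : Fin N → R) (f : Word N → R) :
    actC x t (actC y t f) = actC y t (actC x t f) ∧
    actD x t (actC y t f) = actD y t (actC x t f) ∧
    actC x t (actD y t f) - actC y t (actD x t f) = (x - y) • actD x t (actC y t f) ∧
    actD x t (actD y t f) = actD y t (actD x t f) := by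
  -- The four relations must be carried together: splitting the first site in CC = CC produces the
  -- CD relation and the DC relation on the remaining sites.
  induction N with
  | zero => simp [actC_zero_sites, actD_zero_sites]
  | succ N ih =>
    obtain ⟨h1, h2, h3, h4⟩ := ih (Fin.tail t) (slice 0 f)
    obtain ⟨k1, k2, k3, k4⟩ := ih (Fin.tail t) (slice 1 f)
    refine ⟨ext_slice ?_ ?_, ext_slice ?_ ?_, ext_slice ?_ ?_, ext_slice ?_ ?_⟩ <;>
      simp only [slice_zero_actC, slice_one_actC, slice_zero_actD, slice_one_actD, map_add,
        map_smul, map_sub, map_zero]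
    · linear_combination (norm := module) h1 + k3 + (x + t 0) • k2
    · linear_combination (norm := module) ((x + t 0) * (y + t 0)) • k1
    · linear_combination (norm := module) h1 + k3 + (x + t 0) • k2
    · linear_combination (norm := module) h2 + k4
    · linear_combination (norm := module) (y + t 0) • h1 + (y + t 0) • k3
    · linear_combination (norm := module) h2 + k4

end Monodromy

/-! ### Off-shell Bethe vectors -/

section BetheVectors

variable {R : Type*} [CommRing R] {N : ℕ}

/-- The coordinate vector of `v_{(1,…,1)}`. -/
def vac (R : Type*) [CommRing R] (N : ℕ) : Word N → R := Pi.single (fun _ => 1) 1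

theorem slice_zero_vac : slice 0 (vac R (N + 1)) = 0 := by
  ext l
  rw [slice_apply, vac, Pi.single_eq_of_ne]
  · rfl
  · intro h
    simpa using congrFun h 0

theorem slice_one_vac : slice 1 (vac R (N + 1)) = vac R N := by
  ext l
  have h : (fun _ => 1 : Word (N + 1)) = Fin.cons 1 (fun _ => 1 : Word N) := by
    ext i
    refine Fin.cases ?_ (fun j => ?_) i <;> simp
  simp only [slice_apply, vac, Pi.single_apply, h, Fin.cons_inj, true_and]

theorem actD_vac (x : R) (t : Fin N → R) : actD x t (vac R N) = vac R N := by
  induction N with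
  | zero => simp [actD_zero_sites]
  | succ N ih =>
    apply ext_slice
    · rw [slice_zero_actD, slice_zero_vac]
    · rw [slice_one_actD, slice_zero_vac, slice_one_vac, map_zero, zero_add, ih]

/-- Commutativity of the operators C is what allows a fold over a multiset, so that parameters may
be reordered at will. -/
instance (t : Fin N → R) : LeftCommutative fun (y : R) (f : Word N → R) => actC y t f :=
  ⟨fun x y f => (exchange_relations x y t f).1⟩

/-- The coordinates of `C(y_1) ⋯ C(y_k) v_{(1,…,1)}`. -/
def bvec (t : Fin N → R) (m : Multiset R) : Word N → R :=
  m.foldr (fun y f => actC y t f) (vac R N)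

theorem bvec_zero (t : Fin N → R) : bvec t 0 = vac R N := rfl

theorem bvec_cons (t : Fin N → R) (y : R) (m : Multiset R) :
    bvec t (y ::ₘ m) = actC y t (bvec t m) := Multiset.foldr_cons _ _ _ _

theorem slice_one_bvec (t : Fin (N + 1) → R) (m : Multiset R) :
    slice 1 (bvec t m) = (m.map fun y => y + t 0).prod • bvec (Fin.tail t) m := by
  induction m using Multiset.induction with
  | empty => simp [bvec_zero, slice_one_vac]
  | cons y m ih =>
    rw [bvec_cons, slice_one_actC, ih, map_smul, Multiset.map_cons, Multiset.prod_cons, mul_smul,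
      bvec_cons]

theorem slice_zero_bvec_cons (t : Fin (N + 1) → R) (y : R) (m : Multiset R) :
    slice 0 (bvec t (y ::ₘ m)) = actC y (Fin.tail t) (slice 0 (bvec t m)) +
      (m.map fun y => y + t 0).prod • actD y (Fin.tail t) (bvec (Fin.tail t) m) := by
  rw [bvec_cons, slice_zero_actC, slice_one_bvec, map_smul]

/-- When the parameter x is tuned to the first site, apply C(x) first: every later C(y) meets a
D-term carrying the factor x + t_0 = 0. Thus x is absorbed in turning the first letter into 0. -/
theorem slice_zero_bvec_of_add_eq_zero (t : Fin (N + 1) → R) {x : R} (hx : x + t 0 = 0)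
    (m : Multiset R) : slice 0 (bvec t (x ::ₘ m)) = bvec (Fin.tail t) m := by
  induction m using Multiset.induction with
  | empty =>
    rw [slice_zero_bvec_cons, bvec_zero, bvec_zero, slice_zero_vac, map_zero, zero_add, actD_vac,
      Multiset.map_zero, Multiset.prod_zero, one_smul]
  | cons y m ih =>
    rw [Multiset.cons_swap, slice_zero_bvec_cons, ih, Multiset.map_cons, Multiset.prod_cons, hx,
      zero_mul, zero_smul, add_zero, bvec_cons]

theorem slice_one_bvec_of_add_eq_zero (t : Fin (N + 1) → R) {x : R} (hx : x + t 0 = 0)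
    (m : Multiset R) : slice 1 (bvec t (x ::ₘ m)) = 0 := by
  rw [slice_one_bvec, Multiset.map_cons, Multiset.prod_cons, hx, zero_mul, zero_smul]

/-- Antisymmetrising in x and y eliminates D and leaves a recursion in C alone, which drives the
induction of `slice_zero_bvec_finset`. -/
theorem slice_zero_bvec_exchange (t : Fin (N + 1) → R) (x y : R) (m : Multiset R) :
    (x - y) • slice 0 (bvec t (x ::ₘ y ::ₘ m)) =
      (x + t 0) • actC x (Fin.tail t) (slice 0 (bvec t (y ::ₘ m))) -
        (y + t 0) • actC y (Fin.tail t) (slice 0 (bvec t (x ::ₘ m))) := by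
  simp only [slice_zero_bvec_cons, Multiset.map_cons, Multiset.prod_cons, map_add, map_smul]
  rw [bvec_cons]
  obtain ⟨h1, -, -, -⟩ := exchange_relations x y (Fin.tail t) (slice 0 (bvec t m))
  obtain ⟨-, -, k3, -⟩ := exchange_relations x y (Fin.tail t) (bvec (Fin.tail t) m)
  generalize (m.map fun y => y + t 0).prod = c
  linear_combination (norm := module) -(y + t 0) • h1 - ((y + t 0) * c) • k3

theorem map_monodromy {S : Type*} [CommRing S] (φ : R →+* S) (x : R) (t : Fin N → R)
    (p q : Fin 2 × Word N) : φ (monodromy x t p q) = monodromy (φ x) (fun i => φ (t i)) p q := by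
  have : (monodromy x t).map φ = monodromy (φ x) (fun i => φ (t i)) := by
    change φ.mapMatrix _ = _
    rw [monodromy, monodromy, map_list_prod, List.map_map]
    congr 1
    refine List.map_congr_left fun j _ => ?_
    ext p q
    simp only [Function.comp, RingHom.mapMatrix_apply, Matrix.map_apply, lax0, lax]
    split_ifs
    · generalize finProdFinEquiv (p.1, p.2 j) = a
      generalize finProdFinEquiv (q.1, q.2 j) = b
      fin_cases a <;> fin_cases b <;> simp
    · simp
  exact congrFun (congrFun this p) q

theorem map_bvec {S : Type*} [CommRing S] (φ : R →+* S) (t : Fin N → R) (m : Multiset R)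
    (l : Word N) : φ (bvec t m l) = bvec (fun i => φ (t i)) (m.map φ) l := by
  induction m using Multiset.induction generalizing l with
  | empty =>
    rw [Multiset.map_zero, bvec_zero, bvec_zero, vac, vac, Pi.single_apply, Pi.single_apply]
    split_ifs <;> simp
  | cons y m ih =>
    simp only [Multiset.map_cons, bvec_cons, blockAct_apply, map_sum, map_mul, map_monodromy, ih]

end BetheVectors

/-! ### The pairing of Bethe vectors -/

section Pairing

variable {K : Type*} [Field K] [DecidableEq K] {N : ℕ}

/-- Turning the first letter into 0 uses up one parameter j, and the weights are of Lagrange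
interpolation type. The differences i - j in the denominators are the reason for a field and for
distinct parameters. -/
theorem slice_zero_bvec_finset (t : Fin (N + 1) → K) (s : Finset K) :
    slice 0 (bvec t s.val) = ∑ j ∈ s,
      (∏ i ∈ s.erase j, (i + t 0) / (i - j)) • bvec (Fin.tail t) (s.erase j).val := by
  induction h : s.card using Nat.strong_induction_on generalizing s with
  | _ n ih =>
  obtain rfl | ⟨x, hx⟩ := s.eq_empty_or_nonempty
  · simp [bvec_zero, slice_zero_vac]
  obtain ⟨s, hxs, rfl⟩ : ∃ s', x ∉ s' ∧ s = insert x s' :=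
    ⟨s.erase x, Finset.notMem_erase _ _, (Finset.insert_erase hx).symm⟩
  clear hx
  obtain rfl | ⟨y, hy⟩ := s.eq_empty_or_nonempty
  · have e : (insert x ∅ : Finset K).val = x ::ₘ 0 := rfl
    rw [e, slice_zero_bvec_cons]
    simp [bvec_zero, slice_zero_vac, actD_vac]
  obtain ⟨r, hyr, rfl⟩ : ∃ s', y ∉ s' ∧ s = insert y s' :=
    ⟨s.erase y, Finset.notMem_erase _ _, (Finset.insert_erase hy).symm⟩
  clear hy
  have hxr : x ∉ r := fun h => hxs (Finset.mem_insert_of_mem h)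
  have hxy : x ≠ y := fun h => hxs (h ▸ Finset.mem_insert_self _ _)
  have ix := ih (insert x r).card (by
    rw [← h, Finset.card_insert_of_notMem hxs, Finset.card_insert_of_notMem hxr,
      Finset.card_insert_of_notMem hyr]; omega) _ rfl
  have iy := ih (insert y r).card (by
    rw [← h, Finset.card_insert_of_notMem hxs]; omega) _ rfl
  have key := slice_zero_bvec_exchange t x y r.val
  rw [← Multiset.ndinsert_of_notMem hxr, ← Multiset.ndinsert_of_notMem hyr, ← Finset.insert_val,
    ← Finset.insert_val, ix, iy, ← Multiset.ndinsert_of_notMem hxs, ← Finset.insert_val] at key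
  have e1 : ∀ {a : K} {u : Finset K}, a ∉ u →
      actC a (Fin.tail t) (bvec (Fin.tail t) u.val) = bvec (Fin.tail t) (insert a u).val := by
    intro a u hau
    rw [Finset.insert_val, Multiset.ndinsert_of_notMem hau, bvec_cons]
  have hxy' : x - y ≠ 0 := sub_ne_zero.2 hxy
  have hyx' : y - x ≠ 0 := sub_ne_zero.2 hxy.symm
  refine smul_right_injective _ hxy' (key.trans ?_)
  dsimp only
  rw [Finset.sum_insert hxr, Finset.sum_insert hyr, Finset.sum_insert hxs, Finset.sum_insert hyr]
  rw [Finset.erase_insert hxr, Finset.erase_insert hyr, Finset.erase_insert hxs,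
    Finset.erase_insert_of_ne hxy, Finset.erase_insert hyr]
  rw [Finset.prod_insert hyr, Finset.prod_insert hxr]
  simp only [map_add, map_smul, smul_add, map_sum, e1 hxr, e1 hyr]
  -- For j different from x and y the coefficients match by the partial fraction identity 1/(y - j)
  -- - 1/(x - j) = (x - y)/((x - j)(y - j)).
  have hr : ∀ j ∈ r, (x + t 0) • (∏ i ∈ (insert y r).erase j, (i + t 0) / (i - j)) •
        actC x (Fin.tail t) (bvec (Fin.tail t) ((insert y r).erase j).val) -
      (y + t 0) • (∏ i ∈ (insert x r).erase j, (i + t 0) / (i - j)) •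
        actC y (Fin.tail t) (bvec (Fin.tail t) ((insert x r).erase j).val) =
      (x - y) • (∏ i ∈ (insert x (insert y r)).erase j, (i + t 0) / (i - j)) •
        bvec (Fin.tail t) ((insert x (insert y r)).erase j).val := by
    intro j hj
    have hjx : x ≠ j := fun h => hxr (h ▸ hj)
    have hjy : y ≠ j := fun h => hyr (h ▸ hj)
    have h1 : y ∉ r.erase j := fun h => hyr (Finset.mem_of_mem_erase h)
    have h2 : x ∉ r.erase j := fun h => hxr (Finset.mem_of_mem_erase h)
    have h3 : x ∉ insert y (r.erase j) := by simp [hxy, hxr]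
    have h4 : y ∉ insert x (r.erase j) := by simp [hxy.symm, hyr]
    have hjx' : x - j ≠ 0 := sub_ne_zero.2 hjx
    have hjy' : y - j ≠ 0 := sub_ne_zero.2 hjy
    rw [Finset.erase_insert_of_ne hjy, Finset.erase_insert_of_ne hjx,
      Finset.erase_insert_of_ne hjx, Finset.erase_insert_of_ne hjy, e1 h3, e1 h4,
      Finset.prod_insert h1, Finset.prod_insert h2, Finset.prod_insert h3, Finset.prod_insert h1,
      Finset.insert_comm y x]
    rw [smul_smul, smul_smul, smul_smul, ← sub_smul]
    congr 1
    field_simp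
    ring
  rw [Finset.smul_sum, Finset.smul_sum, Finset.smul_sum, ← Finset.sum_congr rfl hr,
    Finset.sum_sub_distrib]
  match_scalars <;> grind

/-- The complementary word. -/
def complWord (l : Word N) : Word N := fun i => 1 - l i

theorem complWord_cons (s : Fin 2) (l : Word N) :
    complWord (Fin.cons s l : Word (N + 1)) = Fin.cons (1 - s) (complWord l) := by
  ext i
  refine Fin.cases ?_ (fun j => ?_) i <;> simp [complWord]

/-- The bilinear form on coordinate vectors for which `v_λ` is dual to the complementary `v_λ̄`. -/
def pair {R : Type*} [CommRing R] (f g : Word N → R) : R := ∑ l, f l * g (complWord l)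

theorem pair_succ {R : Type*} [CommRing R] (f g : Word (N + 1) → R) :
    pair f g = pair (slice 0 f) (slice 1 g) + pair (slice 1 f) (slice 0 g) := by
  simp only [pair, sum_word_succ, complWord_cons, slice_apply]
  rfl

theorem pair_zero_left {R : Type*} [CommRing R] (g : Word N → R) : pair 0 g = 0 := by
  simp [pair]

theorem pair_zero_right {R : Type*} [CommRing R] (g : Word N → R) : pair g 0 = 0 := by
  simp [pair]

theorem pair_smul_left {R : Type*} [CommRing R] (c : R) (f g : Word N → R) :
    pair (c • f) g = c * pair f g := by
  simp [pair, Finset.mul_sum, mul_assoc]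

theorem pair_smul_right {R : Type*} [CommRing R] (c : R) (f g : Word N → R) :
    pair f (c • g) = c * pair f g := by
  simp [pair, Finset.mul_sum, mul_left_comm]

theorem pair_sum_left {R ι : Type*} [CommRing R] (s : Finset ι) (f : ι → Word N → R)
    (g : Word N → R) : pair (∑ j ∈ s, f j) g = ∑ j ∈ s, pair (f j) g := by
  simp only [pair, Finset.sum_apply, Finset.sum_mul]
  exact Finset.sum_comm

theorem pair_sum_right {R ι : Type*} [CommRing R] (s : Finset ι) (f : ι → Word N → R)
    (g : Word N → R) : pair g (∑ j ∈ s, f j) = ∑ j ∈ s, pair g (f j) := by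
  simp only [pair, Finset.sum_apply, Finset.mul_sum]
  exact Finset.sum_comm

theorem finset_val_eq_cons {α : Type*} [DecidableEq α] {s : Finset α} {a : α} (h : a ∈ s) :
    s.val = a ::ₘ (s.erase a).val := by
  rw [Finset.erase_val, Multiset.cons_erase h]

/-- The dual Cauchy identity for on-shell Bethe vectors. -/
theorem pair_bvec (t : Fin N → K) (ht : Function.Injective t) (Y O : Finset K)
    (hY : ∀ y ∈ Y, ∃ i, y = -t i) (hO : ∀ a ∈ O, ∃ i, a = t i) (hcard : Y.card + O.card = N) :
    pair (bvec t Y.val) (bvec (-t) O.val) = ∏ y ∈ Y, ∏ a ∈ O, (y + a) := by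
  induction N generalizing Y O with
  | zero =>
    obtain rfl : Y = ∅ := Finset.card_eq_zero.1 (by omega)
    obtain rfl : O = ∅ := Finset.card_eq_zero.1 (by omega)
    simp [pair, bvec_zero, vac, Subsingleton.elim _ (fun _ => 1 : Word 0)]
  | succ N ih =>
    have ht' : Function.Injective (Fin.tail t) := ht.comp (Fin.succ_injective N)
    have hneg : Fin.tail (-t) = -Fin.tail t := rfl
    have hY' : ∀ Z ⊆ Y, -t 0 ∉ Z → ∀ y ∈ Z, ∃ i, y = -Fin.tail t i := by
      intro Z hZ h0 y hy
      obtain ⟨i, rfl⟩ := hY y (hZ hy)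
      obtain rfl | ⟨j, rfl⟩ := Fin.eq_zero_or_eq_succ i
      · exact absurd hy h0
      · exact ⟨j, rfl⟩
    have hO' : ∀ Z ⊆ O, t 0 ∉ Z → ∀ y ∈ Z, ∃ i, y = Fin.tail t i := by
      intro Z hZ h0 y hy
      obtain ⟨i, rfl⟩ := hO y (hZ hy)
      obtain rfl | ⟨j, rfl⟩ := Fin.eq_zero_or_eq_succ i
      · exact absurd hy h0
      · exact ⟨j, rfl⟩
    rw [pair_succ]
    -- If -t_0 ∈ Y or t_0 ∈ O, one of the two vectors lives on words with leading letter 0. One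
    -- summand of `pair_succ` then survives and supplies the factors of the product that involve
    -- t_0.
    by_cases h0Y : -t 0 ∈ Y
    · rw [finset_val_eq_cons h0Y, slice_zero_bvec_of_add_eq_zero _ (neg_add_cancel _),
        slice_one_bvec_of_add_eq_zero _ (neg_add_cancel _), pair_zero_left, add_zero,
        slice_one_bvec, pair_smul_right]
      by_cases h0O : t 0 ∈ O
      · rw [Finset.prod_eq_zero h0Y (Finset.prod_eq_zero h0O (neg_add_cancel _)),
          finset_val_eq_cons h0O, Multiset.map_cons, Multiset.prod_cons]
        simp
      · rw [hneg, ih _ ht' _ _ (hY' _ (Finset.erase_subset _ _) (Finset.notMem_erase _ _))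
          (hO' _ subset_rfl h0O)
          (by have := Finset.card_erase_add_one h0Y; omega), ← Finset.mul_prod_erase _ _ h0Y]
        congr 1
        exact Finset.prod_congr rfl fun a _ => add_comm _ _
    by_cases h0O : t 0 ∈ O
    · have e : t 0 + (-t) 0 = 0 := add_neg_cancel _
      rw [finset_val_eq_cons h0O, slice_zero_bvec_of_add_eq_zero _ e,
        slice_one_bvec_of_add_eq_zero _ e, pair_zero_right, zero_add,
        slice_one_bvec, pair_smul_left, hneg,
        ih _ ht' _ _ (hY' _ subset_rfl h0Y)
          (hO' _ (Finset.erase_subset _ _) (Finset.notMem_erase _ _))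
          (by have := Finset.card_erase_add_one h0O; omega)]
      simp_rw [← Finset.mul_prod_erase _ _ h0O]
      rw [Finset.prod_mul_distrib]
      rfl
    -- Pigeonhole: -Y and O lie among the N values of the remaining sites but have N + 1 elements in
    -- total. The right side therefore vanishes.
    · obtain ⟨c, hcY, hcO⟩ : ∃ c, -c ∈ Y ∧ c ∈ O := by
        by_contra! hcon
        have hd : Disjoint (Y.image Neg.neg) O := by
          rw [Finset.disjoint_left]
          intro a ha haO
          obtain ⟨y, hy, rfl⟩ := Finset.mem_image.1 ha
          exact hcon (-y) (by simpa using hy) haO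
        have hsub : Y.image Neg.neg ∪ O ⊆ Finset.univ.image (Fin.tail t) := by
          intro a ha
          rcases Finset.mem_union.1 ha with ha | ha
          · obtain ⟨y, hy, rfl⟩ := Finset.mem_image.1 ha
            obtain ⟨i, rfl⟩ := hY' _ subset_rfl h0Y y hy
            simp
          · obtain ⟨i, rfl⟩ := hO' _ subset_rfl h0O a ha
            simp
        have := Finset.card_le_card hsub
        rw [Finset.card_union_of_disjoint hd, Finset.card_image_of_injective _ neg_injective,
          hcard, Finset.card_image_of_injective _ ht', Finset.card_univ, Fintype.card_fin] at this
        omega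
      -- A term survives only if the deleted parameter belongs to the matching pair -c, c. This
      -- leaves one term from each sum, and the two differ by the sign of c - t_0, so they cancel.
      rw [slice_zero_bvec_finset, slice_zero_bvec_finset, pair_sum_left, pair_sum_right,
        Finset.sum_eq_single_of_mem _ hcY, Finset.sum_eq_single_of_mem _ hcO]
      · rw [slice_one_bvec, slice_one_bvec, pair_smul_left, pair_smul_left, pair_smul_right,
          pair_smul_right, hneg,
          ih _ ht' _ _ (hY' _ (Finset.erase_subset _ _)
            (fun h => h0Y (Finset.mem_of_mem_erase h))) (hO' _ subset_rfl h0O)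
            (by have := Finset.card_erase_add_one hcY; omega),
          ih _ ht' _ _ (hY' _ subset_rfl h0Y) (hO' _ (Finset.erase_subset _ _)
            (fun h => h0O (Finset.mem_of_mem_erase h)))
            (by have := Finset.card_erase_add_one hcO; omega),
          Finset.prod_eq_zero (s := Y) (f := fun y => ∏ a ∈ O, (y + a)) hcY
            (Finset.prod_eq_zero hcO (neg_add_cancel _))]
        change _ * (Finset.prod O _ * _) + Finset.prod Y _ * _ = _
        simp_rw [← Finset.mul_prod_erase O _ hcO]
        rw [← Finset.mul_prod_erase Y _ hcY, ← Finset.mul_prod_erase Y _ hcY,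
          Finset.prod_mul_distrib, Finset.prod_div_distrib, Finset.prod_div_distrib]
        simp only [Pi.neg_apply, sub_neg_eq_add, neg_add_eq_sub, ← sub_eq_add_neg]
        have n1 : ∏ i ∈ Y.erase (-c), (i + c) ≠ 0 := Finset.prod_ne_zero_iff.2 fun i hi h =>
          Finset.ne_of_mem_erase hi (eq_neg_of_add_eq_zero_left h)
        have n2 : ∏ i ∈ O.erase c, (i - c) ≠ 0 := Finset.prod_ne_zero_iff.2 fun i hi h =>
          Finset.ne_of_mem_erase hi (sub_eq_zero.1 h)
        field_simp
        ring
      · intro b hb hbc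
        rw [slice_one_bvec, pair_smul_left, pair_smul_right, hneg,
          ih _ ht' _ _ (hY' _ subset_rfl h0Y) (hO' _ (Finset.erase_subset _ _)
            (fun h => h0O (Finset.mem_of_mem_erase h)))
            (by have := Finset.card_erase_add_one hb; omega),
          Finset.prod_eq_zero (f := fun y => ∏ a ∈ O.erase b, (y + a)) hcY (Finset.prod_eq_zero
            (Finset.mem_erase.2 ⟨hbc.symm, hcO⟩) (neg_add_cancel _)), mul_zero, mul_zero]
      · intro b hb hbc
        rw [slice_one_bvec, pair_smul_left, pair_smul_right, hneg,
          ih _ ht' _ _ (hY' _ (Finset.erase_subset _ _)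
            (fun h => h0Y (Finset.mem_of_mem_erase h))) (hO' _ subset_rfl h0O)
            (by have := Finset.card_erase_add_one hb; omega),
          Finset.prod_eq_zero (f := fun y => ∏ a ∈ O, (y + a))
            (Finset.mem_erase.2 ⟨hbc.symm, hcY⟩) (Finset.prod_eq_zero hcO (neg_add_cancel _)), mul_zero, mul_zero]

end Pairing

/-! ### Statistics of words -/

section Words

variable {N : ℕ}

/-- The number of letters `1` of a word at the positions `≥ k`. -/
def suffixSum (k : ℕ) (l : Word N) : ℕ := ∑ i : Fin N, if k ≤ i then (l i : ℕ) else 0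

theorem suffixSum_zero_cons (s : Fin 2) (l : Word N) :
    suffixSum 0 (Fin.cons s l : Word (N + 1)) = s + suffixSum 0 l := by
  simp [suffixSum, Fin.sum_univ_succ]

theorem suffixSum_succ_cons (k : ℕ) (s : Fin 2) (l : Word N) :
    suffixSum (k + 1) (Fin.cons s l : Word (N + 1)) = suffixSum k l := by
  simp [suffixSum, Fin.sum_univ_succ]

theorem suffixSum_update {l : Word N} {b : Fin N} (hb : l b = 1) (k : ℕ) :
    suffixSum k (Function.update l b 0) + (if k ≤ b then 1 else 0) = suffixSum k l := by
  rw [suffixSum, suffixSum, ← Finset.add_sum_erase _ _ (Finset.mem_univ b),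
    ← Finset.add_sum_erase (a := b) (f := fun i : Fin N => if k ≤ i then (l i : ℕ) else 0) _
      (Finset.mem_univ b)]
  rw [Finset.sum_congr rfl fun i hi => by
    rw [Function.update_of_ne (Finset.ne_of_mem_erase hi)]]
  simp only [Function.update_self, hb]
  split_ifs <;> simp [add_comm]

theorem suffixSum_anti (l : Word N) : Antitone fun k => suffixSum k l := by
  intro k k' h
  refine Finset.sum_le_sum fun i _ => ?_
  split_ifs <;> omega

/-- `ν` dominates `λ` with respect to all final segments. -/
def SuffixGE (m l : Word N) : Prop := ∀ k, suffixSum k l ≤ suffixSum k m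

theorem suffixGE_cons_self (s : Fin 2) {m l : Word N} (h : SuffixGE m l) :
    SuffixGE (Fin.cons s m : Word (N + 1)) (Fin.cons s l : Word (N + 1)) := by
  rintro (_ | k)
  · rw [suffixSum_zero_cons, suffixSum_zero_cons]
    exact Nat.add_le_add_left (h 0) _
  · rw [suffixSum_succ_cons, suffixSum_succ_cons]
    exact h k

theorem suffixGE_cons_self_iff (s : Fin 2) {m l : Word N} :
    SuffixGE (Fin.cons s m : Word (N + 1)) (Fin.cons s l : Word (N + 1)) ↔ SuffixGE m l := by
  refine ⟨fun h k => ?_, suffixGE_cons_self s⟩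
  simpa [suffixSum_succ_cons] using h (k + 1)

theorem suffixGE_zero_one_of_update {m l : Word N} {b : Fin N} (hb : m b = 1)
    (h : SuffixGE (Function.update m b 0) l) :
    SuffixGE (Fin.cons 0 m : Word (N + 1)) (Fin.cons 1 l : Word (N + 1)) := by
  rintro (_ | k)
  · rw [suffixSum_zero_cons, suffixSum_zero_cons, ← suffixSum_update hb 0]
    have := h 0
    simp
    omega
  · rw [suffixSum_succ_cons, suffixSum_succ_cons, ← suffixSum_update hb k]
    exact (h k).trans (Nat.le_add_right _ _)

theorem exists_update_suffixGE {m l : Word N}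
    (h : SuffixGE (Fin.cons 0 m : Word (N + 1)) (Fin.cons 1 l : Word (N + 1))) :
    ∃ b, m b = 1 ∧ SuffixGE (Function.update m b 0) l := by
  have h0 := h 0
  rw [suffixSum_zero_cons, suffixSum_zero_cons] at h0
  have hne : (Finset.univ.filter fun i => m i = 1).Nonempty := by
    by_contra hcon
    rw [Finset.not_nonempty_iff_eq_empty, Finset.filter_eq_empty_iff] at hcon
    have : suffixSum 0 m = 0 := Finset.sum_eq_zero fun i _ => by
      have := hcon (Finset.mem_univ i)
      have : m i = 0 := by omega
      simp [this]
    simp [this] at h0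
  -- The leftmost letter 1 is the one to erase. Suffixes starting after it are unchanged, and those
  -- starting at or before it contain all letters 1, where the inequality of totals has one to
  -- spare.
  obtain ⟨b, hb, hmin⟩ := (Finset.univ.filter fun i => m i = 1).exists_minimal hne
  have hb1 : m b = 1 := by simpa using hb
  refine ⟨b, hb1, fun k => ?_⟩
  have hu := suffixSum_update hb1 k
  have hk := h (k + 1)
  rw [suffixSum_succ_cons, suffixSum_succ_cons] at hk
  split_ifs at hu with hkb
  · have e : suffixSum k m = suffixSum 0 m := by
      refine Finset.sum_congr rfl fun i _ => ?_
      split_ifs with h1 h2 h2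
      · rfl
      · omega
      · have : m i ≠ 1 := fun hi => by
          have := hmin (y := i) (by simpa using hi) (by rw [Fin.le_def]; omega)
          rw [Fin.le_def] at this
          omega
        have : m i = 0 := by omega
        simp [this]
      · rfl
    have := suffixSum_anti l (Nat.zero_le k)
    simp at h0 this
    omega
  · omega

/-- The number of letters `0` of a word. -/
def zeroCount (l : Word N) : ℕ := ∑ i, if l i = 0 then 1 else 0

theorem zeroCount_cons_zero (l : Word N) :
    zeroCount (Fin.cons 0 l : Word (N + 1)) = zeroCount l + 1 := by
  simp only [zeroCount, Fin.sum_univ_succ, Fin.cons_zero, Fin.cons_succ, if_true, add_comm]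

theorem zeroCount_cons_one (l : Word N) :
    zeroCount (Fin.cons 1 l : Word (N + 1)) = zeroCount l := by
  simp only [zeroCount, Fin.sum_univ_succ, Fin.cons_zero, Fin.cons_succ, one_ne_zero, if_false,
    zero_add]

theorem wordLength_eq_sum (l : Word N) :
    wordLength l = ∑ i, ∑ j, if i < j ∧ l j < l i then 1 else 0 := by
  rw [wordLength, invSet, Finset.card_filter, ← Finset.univ_product_univ, Finset.sum_product]
  simp

theorem wordLength_cons_zero (l : Word N) :
    wordLength (Fin.cons 0 l : Word (N + 1)) = wordLength l := by
  simp only [wordLength_eq_sum, Fin.sum_univ_succ, Fin.cons_zero, Fin.cons_succ]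
  simp

theorem wordLength_cons_one (l : Word N) :
    wordLength (Fin.cons 1 l : Word (N + 1)) = wordLength l + zeroCount l := by
  have h : ∀ a : Fin 2, ¬ (1 < a) := by decide
  have h' : ∀ a : Fin 2, a < 1 ↔ a = 0 := by decide
  simp only [wordLength_eq_sum, Fin.sum_univ_succ, zeroCount, Fin.cons_zero, Fin.cons_succ]
  simp [h, h', add_comm]

theorem wordLength_complWord (l : Word N) :
    wordLength (complWord l) = (invSet Fin.revPerm l).card := by
  rw [wordLength_eq_sum, invSet, Finset.card_filter, ← Finset.univ_product_univ,
    Finset.sum_product, Finset.sum_comm]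
  have h : ∀ a b : Fin 2, 1 - a < 1 - b ↔ b < a := by decide
  refine Finset.sum_congr rfl fun i _ => Finset.sum_congr rfl fun j _ => ?_
  simp only [complWord, h, Equiv.Perm.inv_def, Fin.revPerm_symm, Fin.revPerm_apply, Fin.rev_lt_rev]

end Words

/-! ### The matrix of localised Schubert classes -/

section Schubert

variable {R : Type*} {N : ℕ}

/-- The multiset of the `t_i` with `λ_i = a`. -/
def letterVals (t : Fin N → R) (l : Word N) (a : Fin 2) : Multiset R :=
  (((List.finRange N).filter fun i => l i = a).map t : List R)

theorem letterVals_eq_map (t : Fin N → R) (l : Word N) (a : Fin 2) :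
    letterVals t l a = (Finset.univ.filter fun i => l i = a).val.map t := by
  rw [letterVals, ← Multiset.map_coe, ← Multiset.filter_coe]
  rfl

theorem letterVals_cons_self (t : Fin (N + 1) → R) (l : Word N) (a : Fin 2) :
    letterVals t (Fin.cons a l : Word (N + 1)) a = t 0 ::ₘ letterVals (Fin.tail t) l a := by
  simp [letterVals, List.finRange_succ, List.filter_map, Function.comp_def, Fin.tail_def]

theorem letterVals_cons_of_ne (t : Fin (N + 1) → R) (l : Word N) {s a : Fin 2} (h : s ≠ a) :
    letterVals t (Fin.cons s l : Word (N + 1)) a = letterVals (Fin.tail t) l a := by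
  simp [letterVals, List.finRange_succ, List.filter_map, Function.comp_def, Fin.tail_def, h]

theorem map_letterVals {S : Type*} (φ : R → S) (t : Fin N → R) (l : Word N)
    (a : Fin 2) : (letterVals t l a).map φ = letterVals (fun i => φ (t i)) l a := by
  simp [letterVals, Function.comp_def]

theorem letterVals_eq_cons (t : Fin N → R) {l : Word N} {b : Fin N} (hb : l b = 1) :
    letterVals t l 1 = t b ::ₘ letterVals t (Function.update l b 0) 1 := by
  rw [letterVals_eq_map, letterVals_eq_map,
    finset_val_eq_cons (a := b) (s := Finset.univ.filter fun i => l i = 1) (by simpa using hb),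
    Multiset.map_cons]
  congr 3
  ext i
  by_cases h : i = b
  · simp [h]
  · simp [h]

theorem letterVals_eq_val [DecidableEq R] (t : Fin N → R) (ht : Function.Injective t) (l : Word N)
    (a : Fin 2) :
    letterVals t l a = ((Finset.univ.filter fun i => l i = a).image t).val := by
  rw [letterVals_eq_map, Finset.image_val_of_injOn ht.injOn]

variable [CommRing R]

/-- The value at the fixed point `w_μ` of the Schubert class `S^{ω₀}_λ`. -/
def schubert (t : Fin N → R) (l m : Word N) : R :=
  bvec (-t) (letterVals t m 1) (complWord l)

/-- The coordinate is read at the complement of λ, so a leading 0 of λ selects the leading-1 slice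
and conversely. -/
theorem schubert_cons_zero_zero (t : Fin (N + 1) → R) (l m : Word N) :
    schubert t (Fin.cons 0 l : Word (N + 1)) (Fin.cons 0 m : Word (N + 1)) =
      ((letterVals (Fin.tail t) m 1).map fun y => y - t 0).prod * schubert (Fin.tail t) l m := by
  rw [schubert, complWord_cons, letterVals_cons_of_ne _ _ (by decide)]
  rw [sub_zero, ← slice_apply _ (bvec (-t) _), slice_one_bvec]
  simp only [Pi.neg_apply, ← sub_eq_add_neg]
  rfl

theorem schubert_cons_one_one (t : Fin (N + 1) → R) (l m : Word N) :
    schubert t (Fin.cons 1 l : Word (N + 1)) (Fin.cons 1 m : Word (N + 1)) =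
      schubert (Fin.tail t) l m := by
  rw [schubert, complWord_cons, letterVals_cons_self]
  rw [sub_self, ← slice_apply _ (bvec (-t) _), slice_zero_bvec_of_add_eq_zero _ (add_neg_cancel _)]
  rfl

theorem schubert_cons_zero_one (t : Fin (N + 1) → R) (l m : Word N) :
    schubert t (Fin.cons 0 l : Word (N + 1)) (Fin.cons 1 m : Word (N + 1)) = 0 := by
  rw [schubert, complWord_cons, letterVals_cons_self]
  rw [sub_zero, ← slice_apply _ (bvec (-t) _), slice_one_bvec_of_add_eq_zero _ (add_neg_cancel _)]
  rfl

theorem schubert_cons_one_zero (t : Fin (N + 1) → R) (l m : Word N) :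
    schubert t (Fin.cons 1 l : Word (N + 1)) (Fin.cons 0 m : Word (N + 1)) =
      slice 0 (bvec (-t) (letterVals (Fin.tail t) m 1)) (complWord l) := by
  rw [schubert, complWord_cons, letterVals_cons_of_ne _ _ (by decide)]
  rfl

theorem map_schubert {S : Type*} [CommRing S] (φ : R →+* S) (t : Fin N → R) (l m : Word N) :
    φ (schubert t l m) = schubert (fun i => φ (t i)) l m := by
  rw [schubert, map_bvec, map_letterVals, schubert]
  congr 2
  ext i
  simp

/-- Each step of the recursion preserves dominance: equal leading letters are dropped, and a leading
1 of λ over a leading 0 of μ is paid for by erasing some letter 1 of μ. -/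
theorem suffixGE_of_schubert_ne_zero_of_field {K : Type*} [Field K] (t : Fin N → K)
    (ht : Function.Injective t) {l m : Word N} (h : schubert t l m ≠ 0) : SuffixGE m l := by
  classical
  induction N with
  | zero => intro k; simp [suffixSum]
  | succ N ih =>
    have ht' : Function.Injective (Fin.tail t) := ht.comp (Fin.succ_injective N)
    induction l using Fin.consCases with | _ r l => ?_
    induction m using Fin.consCases with | _ s m => ?_
    fin_cases r <;> fin_cases s
    · change schubert t (Fin.cons 0 l) (Fin.cons 0 m) ≠ 0 at h
      rw [schubert_cons_zero_zero] at h
      exact suffixGE_cons_self _ (ih _ ht' (right_ne_zero_of_mul h))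
    · exact absurd (schubert_cons_zero_one _ _ _) h
    · change schubert t (Fin.cons 1 l) (Fin.cons 0 m) ≠ 0 at h
      rw [schubert_cons_one_zero, letterVals_eq_val _ ht', slice_zero_bvec_finset,
        Finset.sum_apply] at h
      obtain ⟨j, hj, hne⟩ := Finset.exists_ne_zero_of_sum_ne_zero h
      obtain ⟨b, hb, rfl⟩ := Finset.mem_image.1 hj
      have hb1 : m b = 1 := by simpa using hb
      refine suffixGE_zero_one_of_update hb1 (ih _ ht' ?_)
      convert right_ne_zero_of_mul hne using 1
      rw [schubert]
      congr 1
      have := letterVals_eq_cons (Fin.tail t) hb1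
      rw [letterVals_eq_val _ ht'] at this
      rw [Finset.erase_val, this, Multiset.erase_cons_head]
    · change schubert t (Fin.cons 1 l) (Fin.cons 1 m) ≠ 0 at h
      rw [schubert_cons_one_one] at h
      exact suffixGE_cons_self _ (ih _ ht' h)

theorem suffixGE_of_schubert_ne_zero [IsDomain R] (t : Fin N → R) (ht : Function.Injective t)
    {l m : Word N} (h : schubert t l m ≠ 0) : SuffixGE m l := by
  have hinj := IsFractionRing.injective R (FractionRing R)
  refine suffixGE_of_schubert_ne_zero_of_field (fun i => algebraMap R (FractionRing R) (t i))
    (hinj.comp ht) ?_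
  rw [← map_schubert]
  exact (map_ne_zero_iff _ hinj).2 h

/-- Only the recursions with equal leading letters occur. A leading 0 contributes one factor for
each later letter 1, a leading 1 contributes nothing. -/
theorem schubert_self (t : Fin N → R) (l : Word N) :
    schubert t l l = ∏ i, ∏ j, if j < i ∧ l j < l i then t i - t j else 1 := by
  induction N with
  | zero => simp [schubert, letterVals, bvec_zero, vac, Subsingleton.elim _ (fun _ => 1 : Word 0)]
  | succ N ih =>
    have h : ∀ a : Fin 2, ¬ (1 < a) := by decide
    have h' : ∀ a : Fin 2, 0 < a ↔ a = 1 := by decide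
    induction l using Fin.consCases with | _ r l => ?_
    simp only [Fin.prod_univ_succ, Fin.cons_zero, Fin.cons_succ]
    fin_cases r
    · change schubert t (Fin.cons 0 l) (Fin.cons 0 l) = _
      rw [schubert_cons_zero_zero, ih, letterVals_eq_map, Multiset.map_map]
      change (∏ i ∈ Finset.univ.filter fun i => l i = 1, (Fin.tail t i - t 0)) * _ = _
      rw [Finset.prod_filter]
      rw [← Finset.prod_mul_distrib]
      simp [h', Fin.tail, ite_mul]
    · change schubert t (Fin.cons 1 l) (Fin.cons 1 l) = _
      rw [schubert_cons_one_one, ih]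
      simp [h, Fin.tail]

theorem dvd_bvec_cons_sub (t : Fin N → R) (x y : R) (m : Multiset R) (l : Word N) :
    x - y ∣ bvec t (x ::ₘ m) l - bvec t (y ::ₘ m) l := by
  rw [bvec_cons, bvec_cons, blockAct_apply, blockAct_apply, ← Finset.sum_sub_distrib]
  refine Finset.dvd_sum fun k _ => ?_
  rw [← sub_mul]
  refine Dvd.dvd.mul_right ?_ _
  -- Modulo x - y the two monodromy matrices coincide, since their entries are natural in the ring.
  rw [← Ideal.mem_span_singleton, ← Ideal.Quotient.eq, map_monodromy, map_monodromy]
  congr 1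
  exact Ideal.Quotient.eq.2 (Ideal.mem_span_singleton_self _)

/-- A transposition that changes μ replaces exactly one spectral parameter, t_i by t_j or
conversely, so `dvd_bvec_cons_sub` applies. -/
theorem dvd_schubert_sub (t : Fin N → R) (l m : Word N) (i j : Fin N) :
    t i - t j ∣ schubert t l m - schubert t l (permWord (Equiv.swap i j) m) := by
  have key : ∀ i j : Fin N, m i = 1 → m j = 0 →
      t i - t j ∣ schubert t l m - schubert t l (permWord (Equiv.swap i j) m) := by
    intro i j hi hj
    have hj' : permWord (Equiv.swap i j) m j = 1 := by simp [permWord, hi]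
    rw [schubert, schubert, letterVals_eq_cons t hi, letterVals_eq_cons t hj']
    have e : Function.update (permWord (Equiv.swap i j) m) j 0 = Function.update m i 0 := by
      ext k
      by_cases hkj : k = j
      · subst hkj
        by_cases hki : k = i
        · simp [hki]
        · simp [Function.update_of_ne hki, hj]
      · by_cases hki : k = i
        · subst hki; simp [Function.update_of_ne hkj, permWord, hj]
        · simp [Function.update_of_ne hkj, Function.update_of_ne hki, permWord,
            Equiv.swap_apply_of_ne_of_ne hki hkj]
    rw [e]
    exact dvd_bvec_cons_sub _ _ _ _ _
  by_cases h : m i = m j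
  · have e : permWord (Equiv.swap i j) m = m := by
      ext k
      simp only [permWord, Equiv.swap_inv]
      rcases eq_or_ne k i with rfl | hki
      · rw [Equiv.swap_apply_left, h]
      rcases eq_or_ne k j with rfl | hkj
      · rw [Equiv.swap_apply_right, h]
      rw [Equiv.swap_apply_of_ne_of_ne hki hkj]
    rw [e, sub_self]
    exact dvd_zero _
  · rcases (by omega : m i = 1 ∧ m j = 0 ∨ m j = 1 ∧ m i = 0) with ⟨h1, h2⟩ | ⟨h1, h2⟩
    · exact key i j h1 h2
    · rw [← neg_dvd, neg_sub, Equiv.swap_comm]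
      exact key j i h1 h2

/-- Orthogonality of the Schubert matrix and the coordinates of the Bethe vectors. -/
theorem pair_bvec_letterVals [IsDomain R] (t : Fin N → R) (ht : Function.Injective t)
    (l m : Word N) (hlm : zeroCount l = zeroCount m) :
    pair (bvec t (letterVals (-t) l 0)) (bvec (-t) (letterVals t m 1)) =
      ∏ j with l j = 0, ∏ i with m i = 1, (t i - t j) := by
  classical
  let φ := algebraMap R (FractionRing R)
  have hinj : Function.Injective φ := IsFractionRing.injective R (FractionRing R)
  have ht' : Function.Injective fun i => φ (t i) := hinj.comp ht
  have ht'' : Function.Injective (-fun i => φ (t i)) := neg_injective.comp ht'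
  have hc : ((Finset.univ.filter fun i => l i = 0)).card +
      ((Finset.univ.filter fun i => m i = 1)).card = N := by
    have h1 : zeroCount m = (Finset.univ.filter fun i => m i = 0).card := by
      rw [Finset.card_filter]; rfl
    have h2 : zeroCount l = (Finset.univ.filter fun i => l i = 0).card := by
      rw [Finset.card_filter]; rfl
    have h3 := Finset.card_filter_add_card_filter_not (s := Finset.univ) fun i => m i = 0
    have h4 : (Finset.univ.filter fun i => ¬ m i = 0) = Finset.univ.filter fun i => m i = 1 :=
      Finset.filter_congr fun i _ => by omega
    rw [h4, Finset.card_univ, Fintype.card_fin] at h3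
    omega
  have := pair_bvec _ ht' ((Finset.univ.filter fun i => l i = 0).image (-fun i => φ (t i)))
    ((Finset.univ.filter fun i => m i = 1).image fun i => φ (t i))
    (by simp only [Finset.mem_image]; rintro _ ⟨i, -, rfl⟩; exact ⟨i, rfl⟩)
    (by simp only [Finset.mem_image]; rintro _ ⟨i, -, rfl⟩; exact ⟨i, rfl⟩)
    (by rw [Finset.card_image_of_injective _ ht', Finset.card_image_of_injective _ ht'', hc])
  rw [← letterVals_eq_val _ ht', ← letterVals_eq_val _ ht'',
    Finset.prod_image ht''.injOn] at this
  apply hinj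
  have e : (-fun i => φ (t i)) = fun i => φ ((-t) i) := by ext i; simp
  rw [e, ← map_letterVals φ (-t), ← map_letterVals φ t] at this
  simp only [map_prod, map_sub]
  convert this using 1
  · simp only [pair, map_sum, map_mul, map_bvec]
  · refine Finset.prod_congr rfl fun j _ => ?_
    rw [Finset.prod_image ht'.injOn]
    refine Finset.prod_congr rfl fun i _ => ?_
    simp [sub_eq_neg_add]

end Schubert

/-! ### Degrees and non-vanishing -/

section Degree

open MvPolynomial

variable {σ : Type*} {N : ℕ}

/-- A vector of weight `k` whose coordinate at `λ` is homogeneous of degree `ℓ(λ) + c`. -/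
def Graded (k c : ℕ) (f : Word N → MvPolynomial σ ℂ) : Prop :=
  ∀ l, (f l).IsHomogeneous (wordLength l + c) ∧ (zeroCount l ≠ k → f l = 0)

theorem Graded.zero (k c : ℕ) : Graded k c (0 : Word N → MvPolynomial σ ℂ) :=
  fun _ => ⟨isHomogeneous_zero _ _ _, fun _ => rfl⟩

theorem Graded.add {k c : ℕ} {f g : Word N → MvPolynomial σ ℂ} (hf : Graded k c f)
    (hg : Graded k c g) : Graded k c (f + g) :=
  fun l => ⟨(hf l).1.add (hg l).1, fun h => by
    rw [Pi.add_apply, (hf l).2 h, (hg l).2 h, add_zero]⟩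

theorem Graded.smul {k c : ℕ} {f : Word N → MvPolynomial σ ℂ} (hf : Graded k c f)
    {x : MvPolynomial σ ℂ} (hx : x.IsHomogeneous 1) : Graded k (c + 1) (x • f) :=
  fun l => ⟨by
    rw [Pi.smul_apply, smul_eq_mul, ← add_assoc, add_comm _ 1]
    exact hx.mul (hf l).1, fun h => by
    rw [Pi.smul_apply, (hf l).2 h, smul_zero]⟩

theorem Graded.slice_one {k c : ℕ} {f : Word (N + 1) → MvPolynomial σ ℂ} (hf : Graded k c f) :
    Graded k (c + k) (slice 1 f) := by
  intro l
  have := hf (Fin.cons 1 l)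
  rw [wordLength_cons_one, zeroCount_cons_one] at this
  refine ⟨?_, this.2⟩
  by_cases h : zeroCount l = k
  · rw [← h, add_comm c, ← add_assoc]
    exact this.1
  · rw [slice_apply, this.2 h]
    exact isHomogeneous_zero _ _ _

theorem Graded.slice_zero {k c : ℕ} {f : Word (N + 1) → MvPolynomial σ ℂ}
    (hf : Graded (k + 1) c f) : Graded k c (slice 0 f) := by
  intro l
  have := hf (Fin.cons 0 l)
  rw [wordLength_cons_zero, zeroCount_cons_zero] at this
  exact ⟨this.1, fun h => this.2 (by omega)⟩

theorem Graded.slice_zero_eq_zero {c : ℕ} {f : Word (N + 1) → MvPolynomial σ ℂ}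
    (hf : Graded 0 c f) : slice 0 f = 0 := by
  ext1 l
  refine (hf (Fin.cons 0 l)).2 ?_
  rw [zeroCount_cons_zero]
  omega

theorem Graded.of_slice {k c : ℕ} {f : Word (N + 1) → MvPolynomial σ ℂ}
    (h0 : slice 0 f = 0 ∨ ∃ k', k = k' + 1 ∧ Graded k' c (slice 0 f))
    (h1 : Graded k (c + k) (slice 1 f)) : Graded k c f := by
  intro l
  induction l using Fin.consCases with | _ s l => ?_
  fin_cases s
  · change (slice 0 f l).IsHomogeneous (wordLength (Fin.cons 0 l : Word (N + 1)) + c) ∧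
      (zeroCount (Fin.cons 0 l : Word (N + 1)) ≠ k → slice 0 f l = 0)
    rw [wordLength_cons_zero, zeroCount_cons_zero]
    rcases h0 with h0 | ⟨k', rfl, h0⟩
    · rw [h0]
      exact ⟨isHomogeneous_zero _ _ _, fun _ => rfl⟩
    · exact ⟨(h0 l).1, fun h => (h0 l).2 (by omega)⟩
  · change (slice 1 f l).IsHomogeneous (wordLength (Fin.cons 1 l : Word (N + 1)) + c) ∧
      (zeroCount (Fin.cons 1 l : Word (N + 1)) ≠ k → slice 1 f l = 0)
    rw [wordLength_cons_one, zeroCount_cons_one]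
    refine ⟨?_, (h1 l).2⟩
    by_cases h : zeroCount l = k
    · rw [h, add_assoc, add_comm k]
      exact (h1 l).1
    · rw [(h1 l).2 h]
      exact isHomogeneous_zero _ _ _

/-- A leading 1 is inverted with each of the k zeros behind it, so passing to the leading-1 slice
raises the offset by k. This explains the offset c + k for D; for C the extra zero is balanced by
the linear factor x + t_0. -/
theorem graded_act {x : MvPolynomial σ ℂ} (hx : x.IsHomogeneous 1) (t : Fin N → MvPolynomial σ ℂ)
    (ht : ∀ i, (t i).IsHomogeneous 1) {k c : ℕ} (f : Word N → MvPolynomial σ ℂ) :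
    (Graded k c f → Graded (k + 1) c (actC x t f)) ∧
      (Graded k (c + k) f → Graded k c (actD x t f)) := by
  induction N generalizing k c with
  | zero =>
    refine ⟨fun _ => ?_, fun h l => ?_⟩
    · rw [actC_zero_sites]
      exact Graded.zero _ _
    · rw [actD_zero_sites]
      refine ⟨?_, (h l).2⟩
      by_cases h0 : k = 0
      · subst h0
        exact (h l).1
      · have := (h l).2 (by simpa [zeroCount] using Ne.symm h0)
        rw [LinearMap.id_apply, this]
        exact isHomogeneous_zero _ _ _
  | succ N ih =>
    have ih' := fun k c f => ih (k := k) (c := c) (Fin.tail t) (fun i => ht i.succ) f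
    refine ⟨fun h => Graded.of_slice (Or.inr ⟨k, rfl, ?_⟩) ?_,
      fun h => Graded.of_slice (Or.inl (slice_zero_actD _ _ _)) ?_⟩
    · rw [slice_zero_actC]
      refine Graded.add ?_ ((ih' _ _ _).2 h.slice_one)
      obtain _ | k := k
      · rw [h.slice_zero_eq_zero, map_zero]
        exact Graded.zero _ _
      · exact (ih' _ _ _).1 h.slice_zero
    · rw [slice_one_actC, ← add_assoc]
      exact ((ih' _ _ _).1 h.slice_one).smul (hx.add (ht 0))
    · rw [slice_one_actD]
      refine Graded.add ?_ ((ih' _ _ _).2 h.slice_one)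
      obtain _ | k := k
      · rw [h.slice_zero_eq_zero, map_zero]
        exact Graded.zero _ _
      · exact (ih' _ _ _).1 h.slice_zero

theorem graded_bvec (t : Fin N → MvPolynomial σ ℂ) (ht : ∀ i, (t i).IsHomogeneous 1)
    (m : Multiset (MvPolynomial σ ℂ)) (hm : ∀ y ∈ m, y.IsHomogeneous 1) :
    Graded m.card 0 (bvec t m) := by
  induction m using Multiset.induction with
  | empty =>
    intro l
    rw [bvec_zero, vac, Multiset.card_zero]
    by_cases h : l = fun _ => 1
    · subst h
      refine ⟨?_, fun h => absurd ?_ h⟩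
      · rw [Pi.single_eq_same, wordLength_eq_sum]
        simpa using isHomogeneous_one _ _
      · simp [zeroCount]
    · rw [Pi.single_eq_of_ne h]
      exact ⟨isHomogeneous_zero _ _ _, fun _ => rfl⟩
  | cons y m ih =>
    rw [bvec_cons, Multiset.card_cons]
    exact (graded_act (hm y (Multiset.mem_cons_self y m)) t ht _).1
      (ih fun z hz => hm z (Multiset.mem_cons_of_mem hz))

theorem schubert_isHomogeneous (t : Fin N → MvPolynomial σ ℂ) (ht : ∀ i, (t i).IsHomogeneous 1)
    (l m : Word N) : (schubert t l m).IsHomogeneous (wordLength (complWord l)) := by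
  refine (graded_bvec (-t) (fun i => (ht i).neg) _ ?_ _).1
  intro y hy
  obtain ⟨i, -, rfl⟩ := List.mem_map.1 (Multiset.mem_coe.1 hy)
  exact ht i

/-- The degree condition is an equality at every dominating word, so nonvanishing is needed at all
of them, not just at λ. The injection e lets the variables be shifted in the induction. -/
theorem schubert_ne_zero {e : Fin N → σ} (he : Function.Injective e) {l m : Word N}
    (h : SuffixGE m l) (hlm : suffixSum 0 l = suffixSum 0 m) :
    schubert (fun i => (X (e i) : MvPolynomial σ ℂ)) l m ≠ 0 := by
  classical
  induction N with
  | zero => simp [schubert, letterVals, bvec_zero, vac, Subsingleton.elim _ (fun _ => 1 : Word 0)]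
  | succ N ih =>
    have he' : Function.Injective fun i : Fin N => e i.succ := he.comp (Fin.succ_injective N)
    have htail : Fin.tail (fun i => (X (e i) : MvPolynomial σ ℂ)) = fun i => X (e i.succ) := rfl
    induction l using Fin.consCases with | _ r l => ?_
    induction m using Fin.consCases with | _ s m => ?_
    rw [suffixSum_zero_cons, suffixSum_zero_cons] at hlm
    fin_cases r <;> fin_cases s
    · change schubert _ (Fin.cons 0 l) (Fin.cons 0 m) ≠ 0
      rw [schubert_cons_zero_zero, htail]
      refine mul_ne_zero (Multiset.prod_ne_zero ?_) 
        (ih he' ((suffixGE_cons_self_iff _).1 h) (by simpa using hlm))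
      intro h0
      obtain ⟨y, hy, h0⟩ := Multiset.mem_map.1 h0
      obtain ⟨i, -, rfl⟩ := List.mem_map.1 (Multiset.mem_coe.1 hy)
      have := he (X_injective (sub_eq_zero.1 h0))
      exact Fin.succ_ne_zero i this
    · have h1 := h 1
      rw [suffixSum_succ_cons, suffixSum_succ_cons] at h1
      simp at hlm
      omega
    · change schubert _ (Fin.cons 1 l) (Fin.cons 0 m) ≠ 0
      obtain ⟨b, hb, hge⟩ := exists_update_suffixGE h
      intro h0
      refine ih he' hge (by have := suffixSum_update hb 0; simp at this hlm; omega) ?_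
      -- Specialising t_0 to the variable of the erased letter tunes that parameter to the first
      -- site. The slice then collapses to the Schubert value at the word with this letter erased,
      -- nonzero by induction.
      let φ : MvPolynomial σ ℂ →ₐ[ℂ] MvPolynomial σ ℂ :=
        aeval (Function.update X (e 0) (X (e b.succ)))
      have hφ0 : φ (X (e 0)) = X (e b.succ) := by simp [φ]
      have hφ : ∀ i : Fin N, φ (X (e i.succ)) = X (e i.succ) := fun i => by
        have : e i.succ ≠ e 0 := fun h => Fin.succ_ne_zero i (he h)
        simp [φ, Function.update_of_ne this]
      have := congrArg (φ : MvPolynomial σ ℂ →+* MvPolynomial σ ℂ) h0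
      rw [map_schubert, map_zero, schubert_cons_one_zero, letterVals_eq_cons _ hb] at this
      have h00 : Fin.tail (fun i : Fin (N + 1) =>
          (φ : MvPolynomial σ ℂ →+* MvPolynomial σ ℂ) (X (e i))) =
            fun i => X (e i.succ) := by
        ext1 i
        exact hφ i
      rw [slice_zero_bvec_of_add_eq_zero, h00] at this
      · rw [schubert, ← this]
        congr 1
        rw [← h00]
        rfl
      · change φ (X (e b.succ)) + - φ (X (e 0)) = 0
        rw [hφ, hφ0, add_neg_cancel]
    · change schubert _ (Fin.cons 1 l) (Fin.cons 1 m) ≠ 0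
      rw [schubert_cons_one_one]
      exact ih he' ((suffixGE_cons_self_iff _).1 h) (by simpa using hlm)

end Degree

/-! ### The dominance order and the length -/

section Order

variable {N : ℕ}

/-- The sum of the positions of the letters `1`. -/
def positionSum (l : Word N) : ℕ := ∑ i : Fin N, (i : ℕ) * (l i : ℕ)

theorem suffixSum_zero (l : Word N) : suffixSum 0 l = ∑ i, (l i : ℕ) := by
  simp [suffixSum]

/-- Iterated, this writes the position sum as the sum of the suffix sums over k ≥ 1, whence its
strict monotonicity for dominance. -/
theorem positionSum_cons (s : Fin 2) (l : Word N) :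
    positionSum (Fin.cons s l : Word (N + 1)) = positionSum l + suffixSum 0 l := by
  simp [positionSum, Fin.sum_univ_succ, suffixSum_zero, add_mul, Finset.sum_add_distrib]

theorem positionSum_le {m l : Word N} (h : SuffixGE m l) : positionSum l ≤ positionSum m := by
  induction N with
  | zero => simp [positionSum]
  | succ N ih =>
    induction l using Fin.consCases with | _ r l => ?_
    induction m using Fin.consCases with | _ s m => ?_
    have h' : SuffixGE m l := fun k => by simpa [suffixSum_succ_cons] using h (k + 1)
    rw [positionSum_cons, positionSum_cons]
    exact Nat.add_le_add (ih h') (h' 0)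

theorem eq_of_positionSum_eq {m l : Word N} (h : SuffixGE m l)
    (h0 : suffixSum 0 l = suffixSum 0 m) (hp : positionSum l = positionSum m) : l = m := by
  induction N with
  | zero => exact Subsingleton.elim _ _
  | succ N ih =>
    induction l using Fin.consCases with | _ r l => ?_
    induction m using Fin.consCases with | _ s m => ?_
    have h' : SuffixGE m l := fun k => by simpa [suffixSum_succ_cons] using h (k + 1)
    rw [positionSum_cons, positionSum_cons] at hp
    rw [suffixSum_zero_cons, suffixSum_zero_cons] at h0
    have h1 := positionSum_le h'
    have h2 := h' 0
    have hl := ih h' (by omega) (by omega)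
    subst hl
    have : r = s := Fin.ext (by omega)
    rw [this]

theorem zeroCount_complWord (l : Word N) : zeroCount (complWord l) = suffixSum 0 l := by
  rw [suffixSum_zero, zeroCount]
  refine Finset.sum_congr rfl fun i _ => ?_
  have h : ∀ a : Fin 2, (if 1 - a = 0 then 1 else 0) = (a : ℕ) := by decide
  exact h (l i)

theorem zeroCount_add_suffixSum (l : Word N) : zeroCount l + suffixSum 0 l = N := by
  rw [suffixSum_zero, zeroCount, ← Finset.sum_add_distrib]
  have h : ∀ a : Fin 2, (if a = 0 then 1 else 0) + (a : ℕ) = 1 := by decide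
  simp [h]

/-- For a fixed number of letters 1 the length is the position sum up to a constant, so it inherits
strict monotonicity. -/
theorem wordLength_complWord_add (l : Word N) :
    wordLength (complWord l) + (suffixSum 0 l).choose 2 = positionSum l := by
  induction N with
  | zero => simp [wordLength_eq_sum, suffixSum, positionSum]
  | succ N ih =>
    induction l using Fin.consCases with | _ r l => ?_
    rw [complWord_cons, positionSum_cons, suffixSum_zero_cons, ← ih l]
    fin_cases r
    · change wordLength (Fin.cons 1 _ : Word (N + 1)) + (0 + _).choose 2 = _
      rw [wordLength_cons_one, zeroCount_complWord, zero_add]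
      ring
    · change wordLength (Fin.cons 0 _ : Word (N + 1)) + (1 + _).choose 2 = _
      rw [wordLength_cons_zero, add_comm 1, Nat.choose_succ_succ' _ 1, Nat.choose_one_right]
      ring

theorem wordLength_lt_of_suffixGE {m l : Word N} (h : SuffixGE m l)
    (h0 : suffixSum 0 l = suffixSum 0 m) (hne : l ≠ m) :
    wordLength (complWord l) < wordLength (complWord m) := by
  have h1 := wordLength_complWord_add l
  have h2 := wordLength_complWord_add m
  have h3 := positionSum_le h
  rw [h0] at h1
  by_contra hcon
  exact hne (eq_of_positionSum_eq h h0 (by omega))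

theorem suffixSum_zero_permWord (w : Equiv.Perm (Fin N)) (l : Word N) :
    suffixSum 0 (permWord w l) = suffixSum 0 l := by
  rw [suffixSum_zero, suffixSum_zero]
  exact Equiv.sum_comp w⁻¹ fun i => (l i : ℕ)

theorem wordLength_swap_lt {l : Word N} {i j : Fin N} (h : (i, j) ∈ invSet Fin.revPerm l) :
    wordLength (complWord (permWord (Equiv.swap i j) l)) < wordLength (complWord l) := by
  simp only [invSet, Finset.mem_filter, Finset.mem_univ, true_and, Equiv.Perm.inv_def,
    Fin.revPerm_symm, Fin.revPerm_apply, Fin.rev_lt_rev] at h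
  obtain ⟨hij, hl⟩ := h
  have hi : l i = 1 := by omega
  have hj : l j = 0 := by omega
  have h1 := wordLength_complWord_add l
  have h2 := wordLength_complWord_add (permWord (Equiv.swap i j) l)
  rw [suffixSum_zero_permWord] at h2
  have h3 : positionSum (permWord (Equiv.swap i j) l) < positionSum l := by
    rw [positionSum, ← Equiv.sum_comp (Equiv.swap i j)]
    have : ∀ k, permWord (Equiv.swap i j) l (Equiv.swap i j k) = l k := fun k => by
      simp [permWord]
    simp only [this]
    refine Finset.sum_lt_sum (fun k _ => ?_) ⟨i, Finset.mem_univ i, ?_⟩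
    · rcases eq_or_ne k i with rfl | hki
      · rw [Equiv.swap_apply_left]
        exact Nat.mul_le_mul_right _ (le_of_lt hij)
      rcases eq_or_ne k j with rfl | hkj
      · simp [hj]
      rw [Equiv.swap_apply_of_ne_of_ne hki hkj]
    · rw [Equiv.swap_apply_left, hi]
      simpa using hij
  omega

theorem suffixSum_rev (j : Fin N) (l : Word N) :
    ∑ i ∈ Finset.Iic j, (permWord Fin.revPerm⁻¹ l i : ℕ) = suffixSum (Fin.rev j : Fin N) l := by
  rw [suffixSum, ← Equiv.sum_comp Fin.revPerm, ← Finset.sum_filter]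
  refine Finset.sum_congr ?_ fun i _ => ?_
  · ext i
    rw [Finset.mem_Iic, Finset.mem_filter, Fin.revPerm_apply, ← Fin.le_def, Fin.rev_le_rev]
    simp
  · simp [permWord]

theorem wordGEw_revPerm_iff (m l : Word N) : wordGEw Fin.revPerm m l ↔ SuffixGE m l := by
  refine ⟨fun h k => ?_, fun h j => ?_⟩
  · by_cases hk : k < N
    · have := h (Fin.rev ⟨k, hk⟩)
      rw [suffixSum_rev, suffixSum_rev, Fin.rev_rev] at this
      exact this
    · have : ∀ l : Word N, suffixSum k l = 0 := fun l =>
        Finset.sum_eq_zero fun i _ => if_neg (by omega)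
      rw [this, this]
  · rw [suffixSum_rev, suffixSum_rev]
    exact h _

theorem wordLength_permWord_inv (w : Equiv.Perm (Fin N)) (l : Word N) :
    wordLength (permWord w⁻¹ l) = (invSet w l).card := by
  rw [wordLength_eq_sum, invSet, Finset.card_filter, ← Finset.univ_product_univ,
    Finset.sum_product]
  symm
  rw [← Equiv.sum_comp w]
  refine Finset.sum_congr rfl fun i _ => ?_
  rw [← Equiv.sum_comp w]
  simp [permWord]

end Order

/-! ### Torus fixed points -/

section FixedPoints

variable {N n : ℕ}

theorem mem_coordPlane_iff (l : Word N) (x : Fin N → ℂ) :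
    x ∈ coordPlane l ↔ ∀ i, l i ≠ 1 → x i = 0 := by
  constructor
  · intro hx i hi
    have : coordPlane l ≤ LinearMap.ker (LinearMap.proj i : (Fin N → ℂ) →ₗ[ℂ] ℂ) := by
      rw [coordPlane, Submodule.span_le]
      rintro _ ⟨k, rfl⟩
      have : i ≠ k.1 := fun h => hi (h ▸ k.2)
      simp [Pi.single_eq_of_ne this]
    exact this hx
  · intro h
    rw [pi_eq_sum_univ' x]
    refine Submodule.sum_mem _ fun i _ => ?_
    by_cases hi : l i = 1
    · refine Submodule.smul_mem _ _ (Submodule.subset_span ⟨⟨i, hi⟩, ?_⟩)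
      ext j
      simp [Pi.single_apply, eq_comm]
    · rw [h i hi, zero_smul]
      exact Submodule.zero_mem _

theorem single_mem_coordPlane_iff (l : Word N) (i : Fin N) :
    (Pi.single i 1 : Fin N → ℂ) ∈ coordPlane l ↔ l i = 1 := by
  rw [mem_coordPlane_iff]
  refine ⟨fun h => ?_, fun h j hj => ?_⟩
  · by_contra hi
    simpa using h i hi
  · rw [Pi.single_eq_of_ne]
    rintro rfl
    exact hj h

theorem fixedPt_injective : Function.Injective (fixedPt : WordOf N n → FixedPt N n) := by
  intro l m h
  have h' : coordPlane l.1 = coordPlane m.1 := congrArg (fun p => p.1.1) h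
  ext i
  have := single_mem_coordPlane_iff l.1 i
  rw [h', single_mem_coordPlane_iff] at this
  omega

theorem IsTorusFixed.single_mem {p : Gr N n} (hp : IsTorusFixed p) {x : Fin N → ℂ} (hx : x ∈ p.1)
    {i : Fin N} (hi : x i ≠ 0) : (Pi.single i 1 : Fin N → ℂ) ∈ p.1 := by
  -- Doubling the i-th coordinate gives d x - x = x_i e_i.
  let d : Fin N → ℂˣ := Function.update 1 i (Units.mk0 2 two_ne_zero)
  have h1 : Matrix.toLin' (Matrix.diagonal fun k => (d k : ℂ)) x ∈ p.1 := by
    have := Submodule.mem_map_of_mem (f := Matrix.toLin' (Matrix.diagonal fun k => (d k : ℂ))) hx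
    rwa [hp d] at this
  have h2 := p.1.smul_mem (x i)⁻¹ (p.1.sub_mem h1 hx)
  convert h2 using 1
  ext k
  rw [Pi.smul_apply, Pi.sub_apply, Matrix.toLin'_apply, Matrix.mulVec_diagonal]
  by_cases hk : k = i
  · subst hk
    simp only [d, Pi.single_eq_same, Function.update_self, Units.val_mk0, smul_eq_mul]
    field_simp
    ring
  · simp [d, hk]

theorem fixedPt_surjective : Function.Surjective (fixedPt : WordOf N n → FixedPt N n) := by
  classical
  rintro ⟨p, hp⟩
  let l : Word N := fun i => if (Pi.single i 1 : Fin N → ℂ) ∈ p.1 then 1 else 0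
  have hl : coordPlane l = p.1 := by
    apply le_antisymm
    · rw [coordPlane, Submodule.span_le]
      rintro _ ⟨i, rfl⟩
      by_contra h
      have := i.2
      simp [l, show (Pi.single i.1 1 : Fin N → ℂ) ∉ p.1 from h] at this
    · intro x hx
      rw [mem_coordPlane_iff]
      intro i hi
      by_contra h
      exact hi (if_pos (hp.single_mem hx h))
  have hn : ∑ i, (l i : ℕ) = n := by
    rw [← finrank_coordPlane (n := ∑ i, (l i : ℕ)) ⟨l, rfl⟩, hl, p.2]
  exact ⟨⟨l, hn⟩, Subtype.ext (Subtype.ext hl)⟩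

/-- The fixed points of `Gr(n, N)` correspond to words with `n` letters `1`. -/
noncomputable def fixedPtEquiv (N n : ℕ) : WordOf N n ≃ FixedPt N n :=
  Equiv.ofBijective fixedPt ⟨fixedPt_injective, fixedPt_surjective⟩

theorem fixedPtEquiv_symm_fixedPt (l : WordOf N n) : (fixedPtEquiv N n).symm (fixedPt l) = l :=
  (fixedPtEquiv N n).symm_apply_apply l

noncomputable instance : Fintype (FixedPt N n) := Fintype.ofEquiv _ (fixedPtEquiv N n)

end FixedPoints

/-! ### Existence and uniqueness of the twisted Schubert classes -/

section Classes

open MvPolynomial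

variable {N n : ℕ}

/-- The twisted Schubert class `S^{ω₀}_λ`. -/
noncomputable def schubertClass (l : WordOf N n) : HT N n :=
  ⟨fun p => schubert X l.1 ((fixedPtEquiv N n).symm p).1, by
    intro m m' i j h
    beta_reduce
    rw [fixedPtEquiv_symm_fixedPt, fixedPtEquiv_symm_fixedPt, h]
    exact dvd_schubert_sub _ _ _ _ _⟩

theorem schubertClass_fixedPt (l m : WordOf N n) :
    (schubertClass l).1 (fixedPt m) = schubert X l.1 m.1 := by
  change schubert X l.1 ((fixedPtEquiv N n).symm (fixedPt m)).1 = _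
  rw [fixedPtEquiv_symm_fixedPt]

theorem suffixSum_zero_wordOf (l : WordOf N n) : suffixSum 0 l.1 = n := by
  rw [suffixSum_zero, l.2]

theorem suffixGE_refl (l : Word N) : SuffixGE l l := fun _ => le_rfl

theorem isTwistedSchubertClass_schubertClass (l : WordOf N n) :
    IsTwistedSchubertClass Fin.revPerm l (schubertClass l) where
  mem_support := by
    rw [schubertClass_fixedPt]
    exact schubert_ne_zero (e := id) Function.injective_id (suffixGE_refl _) rfl
  support_ge m hm := by
    rw [schubertClass_fixedPt] at hm
    rw [wordGEw_revPerm_iff]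
    exact suffixGE_of_schubert_ne_zero _ (X_injective) hm
  value := by
    rw [schubertClass_fixedPt, schubert_self, invSet, Finset.prod_filter,
      ← Finset.univ_product_univ, Finset.prod_product]
    simp
  degree m hm := by
    rw [wordGEw_revPerm_iff] at hm
    rw [schubertClass_fixedPt, wordLength_permWord_inv, ← wordLength_complWord]
    refine (schubert_isHomogeneous _ (isHomogeneous_X _) _ _).totalDegree ?_
    exact schubert_ne_zero (e := id) Function.injective_id hm
      (by rw [suffixSum_zero_wordOf, suffixSum_zero_wordOf])

theorem X_sub_X_irreducible {i j : Fin N} (h : i ≠ j) : Irreducible (X i - X j : P N) := by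
  refine irreducible_of_totalDegree_eq_one
    (((isHomogeneous_X _ _).sub (isHomogeneous_X _ _)).totalDegree ?_) fun x hx => ?_
  · exact sub_ne_zero.2 fun h' => h (X_injective h')
  -- The coefficient of t_i is 1, so the coefficients have only units as common divisors.
  · have := hx (Finsupp.single i 1)
    rw [coeff_sub, coeff_X, coeff_X, if_pos rfl, if_neg, sub_zero] at this
    · exact isUnit_of_dvd_one this
    · intro h'
      exact h.symm ((Finsupp.single_left_inj one_ne_zero).1 h')

theorem X_sub_X_isRelPrime {i j k l : Fin N} (hij : j < i) (hkl : l < k) (h : (i, j) ≠ (k, l)) :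
    IsRelPrime (X i - X j : P N) (X k - X l) := by
  rw [(X_sub_X_irreducible hij.ne').isRelPrime_iff_not_dvd]
  rintro ⟨q, hq⟩
  -- Setting t_i = t_j kills t_i - t_j but not t_k - t_l, as the two decreasing pairs are distinct.
  have := congrArg (aeval (Function.update (X : Fin N → P N) i (X j))) hq
  rw [map_mul, map_sub, map_sub, aeval_X, aeval_X, aeval_X, aeval_X, Function.update_self,
    Function.update_of_ne hij.ne, sub_self, zero_mul, sub_eq_zero] at this
  simp only [Function.update_apply] at this
  split_ifs at this with h1 h2 h2
  · exact hkl.ne (h2.trans h1.symm)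
  · exact h (by rw [h1, X_injective this])
  · have := X_injective this
    subst h2 this
    exact lt_asymm hij hkl
  · exact hkl.ne' (X_injective this)

/-- Undoing an inversion gives a shorter word, where S vanishes; the GKM condition then makes each
factor divide S(μ), and the factors are pairwise coprime. -/
theorem prod_invSet_dvd {S : HT N n} {m : WordOf N n}
    (h : ∀ m' : WordOf N n, wordLength (complWord m'.1) < wordLength (complWord m.1) →
      S.1 (fixedPt m') = 0) :
    ∏ p ∈ invSet Fin.revPerm m.1, (X p.1 - X p.2 : P N) ∣ S.1 (fixedPt m) := by
  have hlt : ∀ p ∈ invSet Fin.revPerm m.1, p.2 < p.1 := by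
    intro p hp
    simp only [invSet, Finset.mem_filter, Finset.mem_univ, true_and, Equiv.Perm.inv_def,
      Fin.revPerm_symm, Fin.revPerm_apply, Fin.rev_lt_rev] at hp
    exact hp.1
  apply Finset.prod_dvd_of_isRelPrime
  · intro p hp q hq hpq
    exact X_sub_X_isRelPrime (hlt p hp) (hlt q hq) hpq
  · intro p hp
    let m' : WordOf N n := ⟨permWord (Equiv.swap p.1 p.2) m.1, by
      rw [← suffixSum_zero, suffixSum_zero_permWord, suffixSum_zero_wordOf]⟩
    have := S.2 m m' p.1 p.2 rfl
    rwa [h m' (wordLength_swap_lt hp), sub_zero] at this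

/-- At a shortest word μ where the classes differ, the difference is divisible by a product of
degree the length of μ. Yet its degree is at most the length of λ, which is strictly smaller since μ
strictly dominates λ. -/
theorem IsTwistedSchubertClass.unique {l : WordOf N n} {S S' : HT N n}
    (h : IsTwistedSchubertClass Fin.revPerm l S) (h' : IsTwistedSchubertClass Fin.revPerm l S') :
    S = S' := by
  by_contra hne
  have hex : ∃ m : WordOf N n, (S - S').1 (fixedPt m) ≠ 0 := by
    by_contra! hcon
    refine hne (sub_eq_zero.1 (Subtype.ext (funext fun p => ?_)))
    obtain ⟨m, rfl⟩ := fixedPt_surjective p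
    exact hcon m
  obtain ⟨m, hm, hmin⟩ := exists_minimalFor_of_wellFoundedLT
    (fun m : WordOf N n => (S - S').1 (fixedPt m) ≠ 0)
    (fun m : WordOf N n => wordLength (complWord m.1)) hex
  have hdvd := prod_invSet_dvd (S := S - S') (m := m) fun m' hm' => by
    by_contra h0
    exact absurd (hmin h0 hm'.le) (not_le.2 hm')
  have hval : (S - S').1 (fixedPt m) = S.1 (fixedPt m) - S'.1 (fixedPt m) := rfl
  have hge : wordGEw Fin.revPerm m.1 l.1 := by
    by_contra hcon
    refine hm ?_
    rw [hval, not_not.1 (mt (h.support_ge m) hcon), not_not.1 (mt (h'.support_ge m) hcon),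
      sub_zero]
  have hlm : l.1 ≠ m.1 := by
    intro hlm
    obtain rfl : l = m := Subtype.ext hlm
    exact hm (by rw [hval, h.value, h'.value, sub_self])
  have hlt := wordLength_lt_of_suffixGE ((wordGEw_revPerm_iff _ _).1 hge)
    (by rw [suffixSum_zero_wordOf, suffixSum_zero_wordOf]) hlm
  have hdeg : ((S - S').1 (fixedPt m)).totalDegree ≤ wordLength (complWord l.1) := by
    rw [hval]
    refine (totalDegree_sub _ _).trans ?_
    rw [h.degree m hge, h'.degree m hge, wordLength_permWord_inv, ← wordLength_complWord, max_self]
  have hprod : (∏ p ∈ invSet Fin.revPerm m.1, (X p.1 - X p.2 : P N)).IsHomogeneous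
      (wordLength (complWord m.1)) := by
    rw [wordLength_complWord, Finset.card_eq_sum_ones]
    exact IsHomogeneous.prod _ _ _ fun p _ => (isHomogeneous_X _ _).sub (isHomogeneous_X _ _)
  have hne0 : ∏ p ∈ invSet Fin.revPerm m.1, (X p.1 - X p.2 : P N) ≠ 0 :=
    ne_zero_of_dvd_ne_zero hm hdvd
  have := totalDegree_le_of_dvd_of_isDomain hdvd hm
  rw [hprod.totalDegree hne0] at this
  omega

end Classes

/-! ### Localisation at the differences -/

section Localisation

open MvPolynomial

variable {N n : ℕ}

theorem resLoc_mk (a : HT N n) (s : loc N) :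
    resLoc N n (LocalizedModule.mk a s) = LocalizedModule.mk a.1 s :=
  LocalizedModule.map_mk _ _ _ _

/-- The product of all differences `t_a - t_b`, `a ≠ b`. -/
noncomputable def allDifferences (N : ℕ) : loc N :=
  ⟨∏ p ∈ Finset.univ.filter (fun p : Fin N × Fin N => p.1 ≠ p.2), (X p.1 - X p.2), by
    refine Submonoid.prod_mem _ fun p hp => Submonoid.subset_closure ⟨p.1, p.2, ?_, rfl⟩
    simpa using hp⟩

theorem allDifferences_smul_mem (f : FixedPt N n → P N) : (allDifferences N : P N) • f ∈ HT N n := by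
  intro l m i j h
  by_cases hij : i = j
  · subst hij
    have : l = m := Subtype.ext (by rw [h]; ext k; simp [permWord])
    rw [this, sub_self, sub_self]
  · rw [Pi.smul_apply, Pi.smul_apply, ← smul_sub]
    rw [smul_eq_mul]
    exact (Finset.dvd_prod_of_mem (fun p : Fin N × Fin N => (X p.1 - X p.2 : P N)) (a := (i, j))
      (by simpa using hij)).mul_right _

/-- Localisation keeps the inclusion injective, and the product of all differences carries every
function into the GKM classes. -/
theorem resLoc_bijective (N n : ℕ) : Function.Bijective (resLoc N n) := by
  refine ⟨LocalizedModule.map_injective _ _ Subtype.val_injective, fun x => ?_⟩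
  induction x using LocalizedModule.induction_on with | _ f s
  refine ⟨LocalizedModule.mk ⟨_, allDifferences_smul_mem f⟩ (allDifferences N * s), ?_⟩
  rw [resLoc_mk]
  exact LocalizedModule.mk_cancel_common_left _ _ _

theorem mk_eq_smul {M : Type*} [AddCommGroup M] [Module (P N) M] (x : M) (s : loc N) :
    LocalizedModule.mk x s = (Localization.mk 1 s : Ploc N) • LocalizedModule.mk x 1 := by
  rw [LocalizedModule.mk_smul_mk, one_smul, mul_one]

theorem mk_smul_one {M : Type*} [AddCommGroup M] [Module (P N) M] (r : P N) (x : M) :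
    (LocalizedModule.mk (r • x) 1 : LocalizedModule (loc N) M) =
      algebraMap (P N) (Ploc N) r • LocalizedModule.mk x 1 := by
  rw [algebraMap_smul, LocalizedModule.smul'_mk]

theorem mk_sum {M ι : Type*} [AddCommGroup M] [Module (P N) M] (s : Finset ι) (f : ι → M) :
    (LocalizedModule.mk (∑ i ∈ s, f i) 1 : LocalizedModule (loc N) M) =
      ∑ i ∈ s, LocalizedModule.mk (f i) 1 :=
  map_sum (LocalizedModule.mkLinearMap (loc N) M) f s

theorem mk_single_eq_smul [DecidableEq (FixedPt N n)] (f : FixedPt N n → P N) (s : loc N) :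
    (LocalizedModule.mk f s : FuncLoc N n) =
      ∑ p, (Localization.mk (f p) s : Ploc N) • fixedPtVec p := by
  have : f = ∑ p, f p • (Pi.single p 1 : FixedPt N n → P N) := by
    ext1 q
    simp [Pi.single_apply]
  conv_lhs => rw [this, mk_eq_smul, mk_sum, Finset.smul_sum]
  refine Finset.sum_congr rfl fun p _ => ?_
  rw [← mk_eq_smul, fixedPtVec, LocalizedModule.mk_smul_mk, mul_one]
  congr!

end Localisation

/-! ### Coordinates of the Bethe vectors -/

section Coordinates

open MvPolynomial

variable {N : ℕ}

theorem repr_opC (y : P N) (u : VN N) :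
    ⇑((vBasis N).repr (opC y u)) = actC y X ((vBasis N).repr u) := by
  rw [← LinearMap.toMatrix_mulVec_repr (vBasis N), opC, LinearMap.toMatrix_toLin]
  rfl

theorem repr_betheVec (l : Word N) :
    ⇑((vBasis N).repr (betheVec l)) = bvec X (letterVals (-X) l 0) := by
  rw [betheVec, letterVals]
  generalize (List.finRange N).filter _ = L
  induction L with
  | nil =>
    ext m
    simp [bvec_zero, vac, Finsupp.single_apply, Pi.single_apply, eq_comm]
  | cons i L ih =>
    rw [List.map_cons, List.prod_cons, Module.End.mul_apply, repr_opC, ih, List.map_cons,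
      ← Multiset.cons_coe, bvec_cons]
    rfl

theorem card_letterVals_zero (l : Word N) (t : Fin N → P N) :
    (letterVals t l 0).card = zeroCount l := by
  rw [letterVals_eq_map, Multiset.card_map, zeroCount, ← Finset.card_filter]
  rfl

theorem bvec_eq_zero_of_zeroCount_ne {l m : Word N} (h : zeroCount m ≠ zeroCount l) :
    bvec X (letterVals (-X : Fin N → P N) l 0) m = 0 := by
  refine (graded_bvec X (isHomogeneous_X _) _ ?_ m).2 (by rwa [card_letterVals_zero])
  intro y hy
  obtain ⟨i, -, rfl⟩ := List.mem_map.1 (Multiset.mem_coe.1 hy)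
  exact (isHomogeneous_X _ i).neg

/-- The orthogonality in matrix form: the Bethe coordinates invert the Schubert matrix up to the
diagonal of denominators. -/
theorem sum_bvec_mul_schubert {n : ℕ} (l m : WordOf N n) :
    ∑ k, bvec X (letterVals (-X) l.1 0) k * schubert X k m.1 =
      if l = m then (betheDenom l.1 : P N) else 0 := by
  have hz : zeroCount l.1 = zeroCount m.1 := by
    have h1 := zeroCount_add_suffixSum l.1
    have h2 := zeroCount_add_suffixSum m.1
    rw [suffixSum_zero_wordOf] at h1 h2
    omega
  refine (pair_bvec_letterVals (X : Fin N → P N) X_injective l.1 m.1 hz).trans ?_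
  split_ifs with h
  · subst h
    rw [betheDenom, Finset.prod_comm, ← Finset.prod_product']
    refine Finset.prod_congr ?_ fun _ _ => rfl
    ext p
    simp only [Finset.mem_product, Finset.mem_filter, Finset.mem_univ, true_and]
    have h2 : ∀ a : Fin 2, a = 1 ↔ a ≠ 0 := by decide
    rw [h2]
  · obtain ⟨i, hm, hl⟩ : ∃ i, m.1 i = 1 ∧ l.1 i = 0 := by
      by_contra! hcon
      have hle : ∀ i ∈ Finset.univ, (m.1 i : ℕ) ≤ (l.1 i : ℕ) := by
        intro i _
        have := hcon i
        by_cases hm : m.1 i = 1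
        · have := this hm
          omega
        · omega
      have := (Finset.sum_eq_sum_iff_of_le hle).1 (by rw [l.2, m.2])
      exact h (Subtype.ext (funext fun i => Fin.ext (this i (Finset.mem_univ i)).symm))
    exact Finset.prod_eq_zero (by simpa using hl)
      (Finset.prod_eq_zero (i := i) (by simpa using hm) (sub_self _))

end Coordinates

/-! ### The isomorphism `Ψ` -/

section Iso

open MvPolynomial

variable (N : ℕ)

/-- The number of letters `1` of a word. -/
def oneCount {N : ℕ} (l : Word N) : Fin (N + 1) :=
  ⟨∑ i, (l i : ℕ), by
    have := zeroCount_add_suffixSum l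
    rw [suffixSum_zero] at this
    omega⟩

/-- The basis `v_λ` of the localised module. -/
noncomputable def vLocBasis : Module.Basis (Word N) (Ploc N) (VNloc N) :=
  (vBasis N).ofIsLocalizedModule (Ploc N) (loc N) (LocalizedModule.mkLinearMap (loc N) (VN N))

theorem vLocBasis_apply (l : Word N) :
    vLocBasis N l = LocalizedModule.mk (vBasis N l) 1 := by
  rw [vLocBasis, Module.Basis.ofIsLocalizedModule_apply, LocalizedModule.mkLinearMap_apply]

/-- The linear map with `v_λ ↦ S^{ω₀}_λ`. -/
noncomputable def psi : VNloc N →ₗ[Ploc N] DirectSum (Fin (N + 1)) fun n => HTloc N n :=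
  (vLocBasis N).constr (Ploc N) fun l =>
    DirectSum.lof (Ploc N) (Fin (N + 1)) (fun n => HTloc N n) (oneCount l)
      (LocalizedModule.mk (schubertClass ⟨l, rfl⟩) 1)

variable {N}

theorem psi_mk_vBasis (n : Fin (N + 1)) (l : WordOf N n) :
    psi N (LocalizedModule.mk (vBasis N l.1) 1) =
      DirectSum.lof (Ploc N) (Fin (N + 1)) (fun n => HTloc N n) n
        (LocalizedModule.mk (schubertClass l) 1) := by
  obtain ⟨l, hl⟩ := l
  obtain rfl : oneCount l = n := Fin.ext hl
  rw [← vLocBasis_apply, psi, Module.Basis.constr_basis]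

theorem lmap_resLoc_psi_mk_vBasis (n : Fin (N + 1)) (l : WordOf N n) :
    DirectSum.lmap (fun n : Fin (N + 1) => resLoc N n)
        (psi N (LocalizedModule.mk (vBasis N l.1) 1)) =
      DirectSum.lof (Ploc N) (Fin (N + 1)) (fun n => FuncLoc N n) n
        (LocalizedModule.mk (schubertClass l).1 1) := by
  rw [psi_mk_vBasis, DirectSum.lmap_lof, resLoc_mk]

theorem lmap_resLoc_psi_normBetheVec (n : Fin (N + 1)) (l : WordOf N n) :
    DirectSum.lmap (fun n : Fin (N + 1) => resLoc N n) (psi N (normBetheVec l.1)) =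
      DirectSum.lof (Ploc N) (Fin (N + 1)) (fun n => FuncLoc N n) n (fixedPtVec (fixedPt l)) := by
  classical
  let F : Word N → FixedPt N n → P N := fun k p =>
    schubert X k ((fixedPtEquiv N n).symm p).1
  have hsum : ∑ k, bvec (X : Fin N → P N) (letterVals (-X) l.1 0) k • F k =
      betheDenom l.1 • (Pi.single (fixedPt l) 1 : FixedPt N n → P N) := by
    ext1 p
    obtain ⟨m, rfl⟩ := fixedPt_surjective p
    rw [Finset.sum_apply]
    have : ∀ k, F k (fixedPt m) = schubert X k m.1 := fun k => by
      simp only [F, fixedPtEquiv_symm_fixedPt]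
    simp only [Pi.smul_apply, smul_eq_mul, this, sum_bvec_mul_schubert, Submonoid.smul_def,
      Pi.single_apply, fixedPt_injective.eq_iff, eq_comm (a := m)]
    split_ifs <;> simp
  have hterm : ∀ k, DirectSum.lmap (fun n : Fin (N + 1) => resLoc N n) (psi N
      (LocalizedModule.mk (bvec (X : Fin N → P N) (letterVals (-X) l.1 0) k • vBasis N k) 1)) =
      DirectSum.lof (Ploc N) (Fin (N + 1)) (fun n => FuncLoc N n) n
        (LocalizedModule.mk (bvec (X : Fin N → P N) (letterVals (-X) l.1 0) k • F k) 1) := by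
    intro k
    -- Words of another weight have coefficient zero in the Bethe vector, so only the n-th summand
    -- is reached.
    by_cases hk : ∑ i, (k i : ℕ) = n
    · rw [mk_smul_one, mk_smul_one, map_smul, map_smul, map_smul,
        lmap_resLoc_psi_mk_vBasis n ⟨k, hk⟩]
      rfl
    · rw [bvec_eq_zero_of_zeroCount_ne, zero_smul, zero_smul, LocalizedModule.zero_mk,
        LocalizedModule.zero_mk, map_zero, map_zero, map_zero]
      have h1 := zeroCount_add_suffixSum l.1
      have h2 := zeroCount_add_suffixSum k
      rw [suffixSum_zero_wordOf] at h1
      rw [suffixSum_zero] at h2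
      omega
  have hb : betheVec l.1 = ∑ k, bvec (X : Fin N → P N) (letterVals (-X) l.1 0) k • vBasis N k := by
    rw [← repr_betheVec, (vBasis N).sum_repr]
  rw [normBetheVec, mk_eq_smul, map_smul, map_smul, hb, mk_sum, map_sum, map_sum,
    Finset.sum_congr rfl fun k _ => hterm k, ← map_sum, ← mk_sum, hsum, ← map_smul,
    LocalizedModule.mk_smul_mk, one_smul, mul_one, LocalizedModule.mk_cancel, fixedPtVec]

theorem lmap_resLoc_psi_surjective :
    Function.Surjective (DirectSum.lmap (fun n : Fin (N + 1) => resLoc N n) ∘ₗ psi N) := by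
  classical
  rw [← LinearMap.range_eq_top, eq_top_iff]
  rintro x -
  induction x using DirectSum.induction_on with
  | zero => exact Submodule.zero_mem _
  | add x y hx hy => exact Submodule.add_mem _ hx hy
  | of n x =>
    change DirectSum.lof (Ploc N) (Fin (N + 1)) (fun n => FuncLoc N n) n x ∈ _
    induction x using LocalizedModule.induction_on with | _ f s
    rw [mk_single_eq_smul, map_sum]
    refine Submodule.sum_mem _ fun p _ => ?_
    rw [map_smul]
    refine Submodule.smul_mem _ _ ?_
    obtain ⟨l, rfl⟩ := fixedPt_surjective p
    exact ⟨normBetheVec l.1, lmap_resLoc_psi_normBetheVec n l⟩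

/-- Words correspond to the torus fixed points of all Grassmannians. -/
noncomputable def wordEquivFixedPts (N : ℕ) : Word N ≃ Σ n : Fin (N + 1), FixedPt N n :=
  (Equiv.sigmaFiberEquiv oneCount).symm.trans <| Equiv.sigmaCongrRight fun n =>
    (Equiv.subtypeEquivRight fun _ => Fin.ext_iff).trans (fixedPtEquiv N n)

/-- Both sides of `Ψ` are free of the same rank. -/
noncomputable def vLocEquivFuncLoc (N : ℕ) :
    VNloc N ≃ₗ[Ploc N] DirectSum (Fin (N + 1)) fun n => FuncLoc N n :=
  (vLocBasis N).equiv
    (DFinsupp.basis fun n : Fin (N + 1) => (Pi.basisFun (P N) (FixedPt N n)).ofIsLocalizedModule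
      (Ploc N) (loc N) (LocalizedModule.mkLinearMap (loc N) (FixedPt N n → P N)))
    (wordEquivFixedPts N)

/-- The composite with restriction is a surjection between free modules of equal finite rank, hence
injective by the Orzech property. As restriction is injective, both properties pass to Ψ. -/
theorem psi_bijective : Function.Bijective (psi N) := by
  have hfin : Module.Finite (Ploc N) (VNloc N) := Module.Finite.of_basis (vLocBasis N)
  have hsurj := lmap_resLoc_psi_surjective (N := N)
  have hinj : Function.Injective (DirectSum.lmap (fun n : Fin (N + 1) => resLoc N n) ∘ₗ psi N) := by
    have := OrzechProperty.injective_of_surjective_endomorphism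
      ((vLocEquivFuncLoc N).symm.toLinearMap ∘ₗ
        (DirectSum.lmap (fun n : Fin (N + 1) => resLoc N n) ∘ₗ psi N))
      ((vLocEquivFuncLoc N).symm.surjective.comp hsurj)
    exact fun x y h => this (congrArg (vLocEquivFuncLoc N).symm h)
  have hres : Function.Injective (DirectSum.lmap fun n : Fin (N + 1) => resLoc N n) :=
    (DirectSum.lmap_injective _).2 fun n => (resLoc_bijective N n).1
  refine ⟨fun x y h => hinj (congrArg (DirectSum.lmap fun n : Fin (N + 1) => resLoc N n) h), fun y => ?_⟩
  obtain ⟨x, hx⟩ := hsurj (DirectSum.lmap (fun n : Fin (N + 1) => resLoc N n) y)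
  exact ⟨x, hres hx⟩

end Iso

end BetheGr

theorem corollary3p11 (N : ℕ) (_hN : 2 ≤ N) :
    ∃ S : ∀ n : Fin (N + 1), BetheGr.WordOf N n → BetheGr.HT N n,
      -- `S n λ` is the twisted Schubert class of `λ` for the longest permutation,
      -- the unique class with the characterising properties
      (∀ n l, BetheGr.IsTwistedSchubertClass Fin.revPerm l (S n l) ∧
        ∀ S', BetheGr.IsTwistedSchubertClass Fin.revPerm l S' → S' = S n l) ∧
      -- restriction to the fixed points identifies the localised cohomologies
      (∀ n : Fin (N + 1), Function.Bijective (BetheGr.resLoc N n)) ∧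
      ∃ Ψ : BetheGr.VNloc N ≃ₗ[BetheGr.Ploc N]
          (DirectSum (Fin (N + 1)) fun n => BetheGr.HTloc N n),
        -- `Ψ` is the unique linear map with `Ψ (v_λ) = S_λ`
        (∀ (n : Fin (N + 1)) (l : BetheGr.WordOf N n),
          Ψ (LocalizedModule.mk (BetheGr.vBasis N l.1) 1) =
            DirectSum.lof (BetheGr.Ploc N) (Fin (N + 1)) (fun n => BetheGr.HTloc N n) n
              (LocalizedModule.mk (S n l) 1)) ∧
        (∀ Φ : BetheGr.VNloc N →ₗ[BetheGr.Ploc N]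
            (DirectSum (Fin (N + 1)) fun n => BetheGr.HTloc N n),
          (∀ (n : Fin (N + 1)) (l : BetheGr.WordOf N n),
            Φ (LocalizedModule.mk (BetheGr.vBasis N l.1) 1) =
              DirectSum.lof (BetheGr.Ploc N) (Fin (N + 1)) (fun n => BetheGr.HTloc N n) n
                (LocalizedModule.mk (S n l) 1)) → Φ = Ψ.toLinearMap) ∧
        -- `Ψ` sends the normalised Bethe vectors to the fixed point basis vectors
        (∀ (n : Fin (N + 1)) (l : BetheGr.WordOf N n),
          DirectSum.lmap (fun n : Fin (N + 1) => BetheGr.resLoc N n)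
              (Ψ (BetheGr.normBetheVec l.1)) =
            DirectSum.lof (BetheGr.Ploc N) (Fin (N + 1)) (fun n => BetheGr.FuncLoc N n) n
              (BetheGr.fixedPtVec (BetheGr.fixedPt l))) := by
  refine ⟨fun n l => BetheGr.schubertClass l, fun n l =>
    ⟨BetheGr.isTwistedSchubertClass_schubertClass l, fun S' hS' =>
      hS'.unique (BetheGr.isTwistedSchubertClass_schubertClass l)⟩,
    fun n => BetheGr.resLoc_bijective N n,
    LinearEquiv.ofBijective (BetheGr.psi N) BetheGr.psi_bijective,
    BetheGr.psi_mk_vBasis, fun Φ hΦ => ?_, BetheGr.lmap_resLoc_psi_normBetheVec⟩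
  refine (BetheGr.vLocBasis N).ext fun l => ?_
  rw [BetheGr.vLocBasis_apply]
  exact (hΦ (BetheGr.oneCount l) ⟨l, rfl⟩).trans
    (BetheGr.psi_mk_vBasis (BetheGr.oneCount l) ⟨l, rfl⟩).symm
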